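/- Let $X$ be a finite-dimensional real Banach space with unit sphere $S_X=\{x\in X:\|x\|=1\}$. For a bounded linear operator $T:X\to X$ let $M_T=\{x\in S_X:\|Tx\|=\|T\|\}$ be its norm attainment set, where $\|T\|$ is the operator norm. (The empty set is regarded as connected; this is relevant only when $X=\{0\}$.) Then the following statements are equivalent: (1) for every bounded linear operator $T:X\to X$ there is a linear subspace $V\subseteq X$ such that $M_T=V\cap S_X$ is the unit sphere of $V$; (2) for every bounded linear operator $T:X\to X$ there is a connected subset $D_T\subseteq S_X$ such that $M_T=D_T\cup(-D_T)$; (3) $X$ is a Euclidean space, i.e. its norm is induced by an inner product. -/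

import Mathlib

open scoped Pointwise

/-- The norm attainment set `M_T` of a bounded linear operator `T`: the set of all unit vectors
at which `T` attains its operator norm. -/
def normAttainmentSet {X Y : Type*} [NormedAddCommGroup X] [NormedSpace ℝ X]
    [NormedAddCommGroup Y] [NormedSpace ℝ Y] (T : X →L[ℝ] Y) : Set X :=
  {x | x ∈ Metric.sphere (0 : X) 1 ∧ ‖T x‖ = ‖T‖}

/-- A real normed space is Euclidean if it is a finite-dimensional Hilbert space: it is
finite-dimensional, and its norm (with its given linear structure) is induced by an inner
product. -/
def IsEuclidean (X : Type*) [NormedAddCommGroup X] [inst : NormedSpace ℝ X] : Prop :=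
  FiniteDimensional ℝ X ∧
    ∃ ip : InnerProductSpace ℝ X, ip.toNormedSpace = inst

open Filter Topology

/-! The substance is (2) ⟹ (3). By Jordan–von Neumann it suffices to prove the parallelogram law for
two independent vectors. Their span carries the restricted norm `M`, and a linear projection onto it
induces a quotient norm `N`. Operators factoring through the projection turn (2) into
`ContactConnected N M`, a statement about two norms on the plane.

Take a contraction from `N` to `M` of maximal determinant and absorb it into `M`, so that `M ≤ N`.
Suppose that one ellipse contains the `N`-ball near a boundary point, and another lies in the
`M`-ball near a boundary point. Then the linear map matching the two ellipses is a contraction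
(`le_of_osculating`): squeezed transversally by `t < 1`, it has near the axis only contacts on the
axis, so connectedness up to sign excludes contacts elsewhere, and contractivity persists as `t`
grows from 0 to 1. Maximality then gives a constant `D` separating the areas of the two kinds of
ellipses (`exists_area_separation`).

These area bounds compare each norm with a quadratic form on a sector between two unit vectors
(`quad_le_sq`, `sq_le_quad`). Maximality also provides two independent contacts, and connectedness a
whole sector where `N = M`; there both norms come from one quadratic form (`exists_quad_eq`). In
coordinates making this arc circular, the same comparisons prolong it by a fixed angle, hence around
the whole circle (`sq_eq_of_local`).

For (3) ⟹ (1), the parallelogram law makes the vectors with `‖T x‖ = ‖T‖ * ‖x‖` a subspace. For (1)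
⟹ (2), the unit sphere of a subspace is connected in dimension at least two, and otherwise an
antipodal pair or empty. -/

/-- The coordinate plane. -/
abbrev Plane : Type := ℝ × ℝ

namespace Plane

/-! ### Frames and areas in the plane -/

/-- The signed area of the parallelogram spanned by two vectors. -/
def area (u v : Plane) : ℝ := u.1 * v.2 - u.2 * v.1

/-- The linear endomorphism of the plane that maps the standard basis to `u`, `v`. -/
def frame (u v : Plane) : Plane →ₗ[ℝ] Plane :=
  (LinearMap.fst ℝ ℝ ℝ).smulRight u + (LinearMap.snd ℝ ℝ ℝ).smulRight v

theorem frame_apply (u v x : Plane) : frame u v x = x.1 • u + x.2 • v := rfl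

theorem frame_mk (u v : Plane) (a b : ℝ) : frame u v (a, b) = a • u + b • v := rfl

@[simp] theorem frame_one_zero (u v : Plane) : frame u v (1, 0) = u := by simp [frame_mk]

@[simp] theorem frame_zero_one (u v : Plane) : frame u v (0, 1) = v := by simp [frame_mk]

theorem eq_frame (B : Plane →ₗ[ℝ] Plane) : B = frame (B (1, 0)) (B (0, 1)) := by
  ext <;> simp [frame_mk]

theorem area_frame (u v x y : Plane) :
    area (frame u v x) (frame u v y) = area x y * area u v := by
  simp only [area, frame_apply, Prod.fst_add, Prod.snd_add, Prod.smul_fst, Prod.smul_snd,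
    smul_eq_mul]
  ring

/-- The inverse of `frame u v` when `u`, `v` are independent. -/
noncomputable def frameInv (u v : Plane) : Plane →ₗ[ℝ] Plane :=
  frame (v.2 / area u v, -u.2 / area u v) (-v.1 / area u v, u.1 / area u v)

theorem frame_frameInv {u v : Plane} (h : area u v ≠ 0) (x : Plane) :
    frame u v (frameInv u v x) = x := by
  ext <;> simp only [frameInv, frame_apply, Prod.fst_add, Prod.snd_add, Prod.smul_fst,
    Prod.smul_snd, smul_eq_mul] <;> field_simp <;> simp only [area] <;> ring

theorem frameInv_frame {u v : Plane} (h : area u v ≠ 0) (x : Plane) :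
    frameInv u v (frame u v x) = x := by
  ext <;> simp only [frameInv, frame_apply, Prod.fst_add, Prod.snd_add, Prod.smul_fst,
    Prod.smul_snd, smul_eq_mul] <;> field_simp <;> simp only [area] <;> ring

theorem frame_injective {u v : Plane} (h : area u v ≠ 0) : Function.Injective (frame u v) :=
  Function.LeftInverse.injective (frameInv_frame h)

/-! ### Norms on the plane and their contact sets -/

/-- For every contraction from `(ℝ², N)` to `(ℝ², M)`, the unit vectors whose norm is preserved form
a set that is connected up to sign. -/
def ContactConnected (N M : Seminorm ℝ Plane) : Prop :=
  ∀ B : Plane →ₗ[ℝ] Plane, (∀ x, M (B x) ≤ N x) →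
    ∃ D : Set Plane, IsPreconnected D ∧ {x | N x = 1 ∧ M (B x) = 1} = D ∪ (-D)

/-- The seminorm vanishes only at the origin. -/
def Definite (N : Seminorm ℝ Plane) : Prop := ∀ x, N x = 0 → x = 0

theorem Definite.pos {N : Seminorm ℝ Plane} (h : Definite N) {x : Plane} (hx : x ≠ 0) :
    0 < N x :=
  lt_of_le_of_ne (apply_nonneg N x) fun h0 => hx (h x h0.symm)

theorem Definite.comp {N : Seminorm ℝ Plane} (h : Definite N) {u v : Plane} (huv : area u v ≠ 0) :
    Definite (N.comp (frame u v)) := fun x hx =>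
  frame_injective huv (by rw [map_zero]; exact h _ hx)

theorem seminorm_continuous (N : Seminorm ℝ Plane) : Continuous N := by
  have := ConvexOn.continuousOn isOpen_univ N.convexOn
  exact continuousOn_univ.1 this

theorem ContactConnected.comp_right {N M : Seminorm ℝ Plane} (h : ContactConnected N M)
    (A : Plane →ₗ[ℝ] Plane) : ContactConnected N (M.comp A) :=
  fun B hB => h (A ∘ₗ B) hB

theorem ContactConnected.comp_left {N M : Seminorm ℝ Plane} (h : ContactConnected N M)
    {u v : Plane} (huv : area u v ≠ 0) : ContactConnected (N.comp (frame u v)) M := by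
  intro B hB
  obtain ⟨D, hD, hDe⟩ := h (B ∘ₗ frameInv u v) fun x => by
    have := hB (frameInv u v x)
    rwa [Seminorm.comp_apply, frame_frameInv huv] at this
  refine ⟨frameInv u v '' D, hD.image _
    (LinearMap.continuous_of_finiteDimensional _).continuousOn, ?_⟩
  ext x
  have hx : x ∈ {x | (N.comp (frame u v)) x = 1 ∧ M (B x) = 1} ↔
      frame u v x ∈ {x | N x = 1 ∧ M ((B ∘ₗ frameInv u v) x) = 1} := by
    simp [frameInv_frame huv]
  rw [hx, hDe]
  have key : ∀ y : Plane, frame u v y ∈ D ↔ y ∈ frameInv u v '' D := fun y =>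
    ⟨fun hy => ⟨_, hy, frameInv_frame huv y⟩, by
      rintro ⟨z, hz, rfl⟩
      rwa [frame_frameInv huv]⟩
  simp only [Set.mem_union, Set.mem_neg, ← map_neg, key]

theorem exists_mul_norm_le {N : Seminorm ℝ Plane} (hN : Definite N) :
    ∃ c > 0, ∀ x, c * ‖x‖ ≤ N x := by
  obtain ⟨x, hx, hmin⟩ := (isCompact_sphere (0 : Plane) 1).exists_isMinOn
    ((NormedSpace.sphere_nonempty (x := (0 : Plane))).2 zero_le_one)
    (seminorm_continuous N).continuousOn
  have hx0 : x ≠ 0 := by rintro rfl; simp at hx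
  refine ⟨N x, hN.pos hx0, fun y => ?_⟩
  rcases eq_or_ne y 0 with rfl | hy
  · simp
  have hy' : 0 < ‖y‖ := norm_pos_iff.2 hy
  have := hmin (show ‖y‖⁻¹ • y ∈ Metric.sphere (0 : Plane) 1 by simp [norm_smul, hy'.ne'])
  simp only [Set.mem_ofPred_eq, map_smul_eq_mul, norm_inv, norm_norm] at this
  rwa [inv_mul_eq_div, le_div_iff₀ hy'] at this

theorem isCompact_unit_sphere {N : Seminorm ℝ Plane} (hN : Definite N) :
    IsCompact {x | N x = 1} := by
  obtain ⟨c, hc, h⟩ := exists_mul_norm_le hN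
  refine (isCompact_closedBall (0 : Plane) c⁻¹).of_isClosed_subset
    (isClosed_eq (seminorm_continuous N) continuous_const) fun x hx => ?_
  have := h x
  rw [Set.mem_ofPred_eq] at hx
  rw [hx] at this
  simp only [Metric.mem_closedBall, dist_zero_right]
  rwa [← one_div, le_div_iff₀ hc, mul_comm]

theorem le_of_unit_sphere {N M : Seminorm ℝ Plane} (hN : Definite N) {B : Plane →ₗ[ℝ] Plane}
    (h : ∀ x, N x = 1 → M (B x) ≤ 1) (x : Plane) : M (B x) ≤ N x := by
  rcases eq_or_ne x 0 with rfl | hx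
  · simp
  have hx' := hN.pos hx
  have := h ((N x)⁻¹ • x) (by simp [map_smul_eq_mul, abs_of_pos hx', hx'.ne'])
  simp only [map_smul, map_smul_eq_mul, norm_inv, Real.norm_eq_abs, abs_of_pos hx'] at this
  rwa [inv_mul_le_iff₀ hx', mul_one] at this

theorem seminorm_mk (N : Seminorm ℝ Plane) {a : ℝ} (ha : a ≠ 0) (b : ℝ) :
    N (a, b) = |a| * N (1, b / a) := by
  rw [← Real.norm_eq_abs, ← map_smul_eq_mul]
  simp [mul_div_cancel₀ b ha]

/-! ### From local comparison at a contact to global contraction -/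

/-- A contact that is strict off its own line is the only one, up to sign. -/
theorem eq_of_isolated_contact {N : Seminorm ℝ Plane} {C D : Set Plane} (hD : IsPreconnected D)
    (hC : C = D ∪ (-D)) (hCN : ∀ x ∈ C, N x = 1) (hN1 : N (1, 0) = 1)
    (h1 : ((1, 0) : Plane) ∈ C) {η : ℝ}
    (hη : 0 < η) (hiso : ∀ x ∈ C, |x.2| < η * |x.1| → x.2 = 0) :
    ∀ x ∈ C, |x.2| < η * |x.1| := by
  have main : ∀ D : Set Plane, IsPreconnected D → C = D ∪ (-D) → ((1, 0) : Plane) ∈ D →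
      ∀ x ∈ C, |x.2| < η * |x.1| := by
    intro D hD hC h1 x hx
    by_contra hxη
    obtain ⟨y, hyD, hy⟩ : ∃ y ∈ D, ¬ |y.2| < η * |y.1| := by
      rw [hC] at hx
      rcases hx with hx | hx
      · exact ⟨x, hx, hxη⟩
      · exact ⟨-x, hx, by simpa using hxη⟩
    have hUo : IsOpen {z : Plane | 0 < z.1 ∧ |z.2| < η * |z.1|} :=
      (isOpen_lt continuous_const continuous_fst).inter
        (isOpen_lt continuous_snd.abs (continuous_const.mul continuous_fst.abs))
    have hVo : IsOpen {z : Plane | z ≠ (1, 0)} := isOpen_ne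
    -- The half-cone around `(1, 0)` and the complement of `(1, 0)` cover the plane; both meet `D`,
    -- so by connectedness `D` has a point of the half-cone other than `(1, 0)`.
    obtain ⟨z, hzD, ⟨hz1, hzη⟩, hz⟩ := hD _ _ hUo hVo (fun z _ => by
        by_cases hz : z = (1, 0)
        · left; simp [hz, hη]
        · right; exact hz) ⟨(1, 0), h1, by simp [hη]⟩
      ⟨y, hyD, by rintro rfl; simp [hη] at hy⟩
    have hzC : z ∈ C := hC ▸ Or.inl hzD
    have hz2 := hiso z hzC hzη
    have hNz := hCN z hzC
    have : z = (z.1, 0) := Prod.ext rfl hz2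
    rw [this, seminorm_mk N hz1.ne', zero_div, hN1, mul_one, abs_of_pos hz1] at hNz
    exact hz (by rw [this, hNz])
  have h1' := h1
  rw [hC] at h1'
  rcases h1' with h | h
  · exact main D hD hC h
  · refine main (-D) ?_ (by rw [neg_neg, Set.union_comm]; exact hC) h
    have := hD.image Neg.neg continuous_neg.continuousOn
    rwa [Set.image_neg_eq_neg] at this

/-- A local minimum of the convex function `b ↦ N (1, b)` is global; homogeneity does the rest. -/
theorem abs_le_of_local_support {N : Seminorm ℝ Plane} (hN1 : N (1, 0) = 1)
    (hl : ∀ᶠ b : ℝ in 𝓝 0, 1 ≤ N (1, b)) (x : Plane) : |x.1| ≤ N x := by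
  have hconv : ConvexOn ℝ Set.univ fun b : ℝ => N (1, b) := by
    refine ⟨convex_univ, fun x _ y _ a b ha hb hab => ?_⟩
    have : ((1, a • x + b • y) : Plane) = a • ((1, x) : Plane) + b • ((1, y) : Plane) := by
      ext <;> simp [hab]
    calc N (1, a • x + b • y) ≤ N (a • ((1, x) : Plane)) + N (b • ((1, y) : Plane)) := by
          rw [this]; exact map_add_le_add N _ _
      _ = _ := by
          rw [map_smul_eq_mul, map_smul_eq_mul, Real.norm_of_nonneg ha, Real.norm_of_nonneg hb]
          rfl
  have hmin : ∀ b : ℝ, 1 ≤ N (1, b) := by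
    have := IsMinOn.of_isLocalMin_of_convex_univ (f := fun b : ℝ => N (1, b)) (a := 0)
      (by simpa [IsLocalMin, IsMinFilter, hN1] using hl) hconv
    intro b
    simpa [hN1] using this b
  obtain ⟨a, b⟩ := x
  rcases eq_or_ne a 0 with rfl | ha
  · simp
  · rw [seminorm_mk N ha]
    exact le_mul_of_one_le_right (abs_nonneg a) (hmin _)

/-- A continuity argument along the maps `diag(1, t)`. At `t = 0` the map is a contraction by local
support. For `t < 1` the two local bounds are strict off the axis, so contacts near `(1, 0)` are
isolated up to sign and connectedness forbids all others. Compactness then lets `t` increase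
further. -/
theorem le_of_osculating {N M : Seminorm ℝ Plane} (hN : Definite N)
    (h : ContactConnected N M) (hN1 : N (1, 0) = 1) (hM1 : M (1, 0) = 1)
    (hNl : ∀ᶠ b : ℝ in 𝓝 0, 1 + b ^ 2 ≤ N (1, b) ^ 2)
    (hMu : ∀ᶠ b : ℝ in 𝓝 0, M (1, b) ^ 2 ≤ 1 + b ^ 2) (x : Plane) : M x ≤ N x := by
  obtain ⟨η, hη, hloc⟩ := Metric.eventually_nhds_iff.1 (hNl.and hMu)
  simp only [dist_zero_right, Real.norm_eq_abs] at hloc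
  set B : ℝ → Plane →ₗ[ℝ] Plane := fun t => frame (1, 0) (0, t) with hB
  have hBx : ∀ t x, B t x = (x.1, t * x.2) := fun t x => by
    ext <;> simp [hB, frame_apply, mul_comm]
  have hBc : Continuous fun z : ℝ × Plane => M (B z.1 z.2) := by
    simp only [hBx]
    exact (seminorm_continuous M).comp (by fun_prop)
  have near : ∀ t, 0 ≤ t → t < 1 → ∀ x : Plane, |x.2| < η * |x.1| →
      M (B t x) ≤ N x ∧ (M (B t x) = N x → x.2 = 0) := by
    rintro t ht0 ht1 ⟨a, b⟩ hab
    simp only at hab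
    have ha : a ≠ 0 := by rintro rfl; simp at hab; exact absurd (abs_nonneg b) (not_le.2 hab)
    have ha' := abs_pos.2 ha
    have hb : |b / a| < η := by rwa [abs_div, div_lt_iff₀ ha']
    have htb : |t * (b / a)| < η := by
      rw [abs_mul, abs_of_nonneg ht0]
      exact (mul_le_of_le_one_left (abs_nonneg _) ht1.le).trans_lt hb
    have h1 := (hloc hb).1
    have h2 := (hloc htb).2
    have h3 : (t * (b / a)) ^ 2 ≤ (b / a) ^ 2 := by
      rw [mul_pow]
      exact mul_le_of_le_one_left (sq_nonneg _) (by nlinarith)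
    rw [hBx, seminorm_mk N ha, seminorm_mk M ha, mul_div_assoc]
    refine ⟨mul_le_mul_of_nonneg_left (abs_le_of_sq_le_sq' (by linarith)
      (apply_nonneg N _)).2 ha'.le, fun he => ?_⟩
    have he' := mul_left_cancel₀ ha'.ne' he
    rw [he'] at h2
    have h4 : (1 - t ^ 2) * (b / a) ^ 2 ≤ 0 := by nlinarith
    have h5 : (b / a) ^ 2 ≤ 0 := by
      by_contra hc
      nlinarith [mul_pos (show 0 < 1 - t ^ 2 by nlinarith) (not_le.1 hc)]
    have h6 : b / a = 0 := pow_eq_zero_iff two_ne_zero |>.1 (le_antisymm h5 (sq_nonneg _))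
    simpa [ha] using h6
  have hzero : ∀ x, M (B 0 x) ≤ N x := by
    rintro ⟨a, b⟩
    have h1 : M (B 0 (a, b)) = |a| := by
      rw [hBx]
      rcases eq_or_ne a 0 with rfl | ha
      · simp only [zero_mul, abs_zero]
        exact map_zero M
      · rw [seminorm_mk M ha]; simp [hM1]
    rw [h1]
    refine abs_le_of_local_support hN1 ?_ (a, b)
    filter_upwards [hNl] with b hb
    exact (abs_le_of_sq_le_sq' (by nlinarith [sq_nonneg b]) (apply_nonneg N _)).2
  have step : ∀ s ∈ Set.Ico (0 : ℝ) 1, ∀ x, M (B s x) ≤ N x := by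
    rintro s ⟨hs0, hs1⟩
    have hTc : IsCompact {t ∈ Set.Icc 0 s | ∀ x, M (B t x) ≤ N x} := by
      refine isCompact_Icc.of_isClosed_subset ?_ (fun t ht => ht.1)
      have hcl : IsClosed {t : ℝ | ∀ x, M (B t x) ≤ N x} := by
        simp only [Set.ofPred_forall]
        exact isClosed_iInter fun x => isClosed_le
          (hBc.comp (by fun_prop : Continuous fun s : ℝ => (s, x))) continuous_const
      exact isClosed_Icc.inter hcl
    obtain ⟨t, ⟨⟨ht0, hts⟩, htN⟩, htmax⟩ :=
      hTc.exists_isGreatest ⟨0, ⟨le_rfl, hs0⟩, hzero⟩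
    rcases hts.eq_or_lt with rfl | hts
    · exact htN
    exfalso
    have ht1 : t < 1 := hts.trans hs1
    have hKc : IsCompact {x : Plane | N x = 1 ∧ η * |x.1| ≤ |x.2|} :=
      (isCompact_unit_sphere hN).inter_right
        (isClosed_le (continuous_const.mul continuous_fst.abs) continuous_snd.abs)
    have hcontact : ∀ x, N x = 1 → η * |x.1| ≤ |x.2| → M (B t x) < 1 := by
      intro x hx1 hxη
      refine lt_of_le_of_ne (hx1 ▸ htN x) fun hx2 => ?_
      obtain ⟨D, hD, hDe⟩ := h (B t) htN
      refine not_lt.2 hxη (eq_of_isolated_contact hD hDe (fun z hz => hz.1) hN1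
        ⟨hN1, by simpa [hBx] using hM1⟩ hη (fun z hz hzη => ?_) x ⟨hx1, hx2⟩)
      exact (near t ht0 ht1 z hzη).2 (hz.2.trans hz.1.symm)
    -- Away from the cone the inequality is strict on a compact set, hence stable in the parameter;
    -- inside the cone `near` applies to every parameter below 1.
    have hev : ∀ᶠ r in 𝓝 t, ∀ x ∈ {x : Plane | N x = 1 ∧ η * |x.1| ≤ |x.2|},
        M (B r x) < 1 := by
      refine hKc.eventually_forall_of_forall_eventually fun x hx => ?_
      exact hBc.continuousAt.eventually_lt_const (hcontact x hx.1 hx.2)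
    obtain ⟨r, hr, htr, hrs⟩ :=
      ((hev.filter_mono nhdsWithin_le_nhds).and (Ioo_mem_nhdsGT hts)).exists
    refine not_le.2 htr (htmax ⟨⟨ht0.trans htr.le, hrs.le⟩,
      le_of_unit_sphere hN fun x hx => ?_⟩)
    rcases lt_or_ge |x.2| (η * |x.1|) with hx2 | hx2
    · exact hx ▸ (near r (ht0.trans htr.le) (hrs.trans hs1) x hx2).1
    · exact (hr x ⟨hx, hx2⟩).le
  have hlim : Tendsto (fun s : ℝ => M (B s x)) (𝓝[<] 1) (𝓝 (M (B 1 x))) :=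
    ((hBc.comp (by fun_prop : Continuous fun s : ℝ => (s, x))).tendsto 1).mono_left
      nhdsWithin_le_nhds
  have h1x : B 1 x = x := by rw [hBx, one_mul]
  rw [h1x] at hlim
  refine le_of_tendsto hlim ?_
  filter_upwards [Ico_mem_nhdsLT (zero_lt_one' ℝ)] with s hs using step s hs x

/-! ### Osculating ellipses and their areas -/

/-- The unit vector `u` and the direction `v` exhibit an ellipse, centred at the origin, that
contains the unit ball of `N` near `u`. -/
def Lower (N : Seminorm ℝ Plane) (u v : Plane) : Prop :=
  N u = 1 ∧ ∀ᶠ b : ℝ in 𝓝 0, 1 + b ^ 2 ≤ N (u + b • v) ^ 2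

/-- The unit vector `u` and the direction `v` exhibit an ellipse, centred at the origin, that is
contained in the unit ball of `N` near `u`. -/
def Upper (N : Seminorm ℝ Plane) (u v : Plane) : Prop :=
  N u = 1 ∧ ∀ᶠ b : ℝ in 𝓝 0, N (u + b • v) ^ 2 ≤ 1 + b ^ 2

/-- The map carrying `u`, `v` to `w`, `z` is a contraction, and its determinant is the quotient of
the two areas. -/
theorem area_le_of_osculating {N M : Seminorm ℝ Plane} (hN : Definite N)
    (h : ContactConnected N M)
    (hdet : ∀ u v, (∀ x, M (frame u v x) ≤ N x) → |area u v| ≤ 1)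
    {u v w z : Plane} (hu : area u v ≠ 0) (hl : Lower N u v) (hw : Upper M w z) :
    |area w z| ≤ |area u v| := by
  have hc : ContactConnected (N.comp (frame u v)) (M.comp (frame w z)) :=
    (h.comp_left hu).comp_right _
  have := le_of_osculating (hN.comp hu) hc (by simpa using hl.1) (by simpa using hw.1)
    (by simpa [frame_mk] using hl.2) (by simpa [frame_mk] using hw.2)
  have hd := hdet (frame w z (frameInv u v (1, 0))) (frame w z (frameInv u v (0, 1))) fun x => by
    have hx := this (frameInv u v x)
    rw [Seminorm.comp_apply, Seminorm.comp_apply, frame_frameInv hu] at hx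
    rwa [← LinearMap.comp_apply, ← LinearMap.comp_apply, ← eq_frame]
  have he := area_frame u v (frameInv u v (1, 0)) (frameInv u v (0, 1))
  rw [frame_frameInv hu, frame_frameInv hu] at he
  have h1 : area ((1, 0) : Plane) (0, 1) = 1 := by simp [area]
  rw [h1] at he
  rw [area_frame] at hd
  have hpos : 0 < |area u v| := abs_pos.2 hu
  calc |area w z| = |area (frameInv u v (1, 0)) (frameInv u v (0, 1)) * area w z| * |area u v| := by
        rw [← abs_mul, mul_right_comm, ← he, one_mul]
    _ ≤ 1 * |area u v| := by gcongr
    _ = _ := one_mul _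

/-! ### Quadratic forms touching a norm on a quadrant -/

/-- The quadratic form taking the value `1` on the standard basis, with polar coefficient `k`. -/
def quad (k : ℝ) (x : Plane) : ℝ := x.1 ^ 2 + 2 * k * x.1 * x.2 + x.2 ^ 2

theorem continuous_quad (k : ℝ) : Continuous (quad k) := by
  unfold quad
  fun_prop

theorem quad_smul (k t : ℝ) (x : Plane) : quad k (t • x) = t ^ 2 * quad k x := by
  simp only [quad, Prod.smul_fst, Prod.smul_snd, smul_eq_mul]
  ring

theorem quad_pos {k : ℝ} (hk : 0 ≤ k) {x : Plane} (h1 : 0 ≤ x.1) (h2 : 0 ≤ x.2) (hx : x ≠ 0) :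
    0 < quad k x := by
  have h3 : 0 ≤ 2 * k * x.1 * x.2 := by positivity
  unfold quad
  rcases h1.lt_or_eq with h | h
  · positivity
  rcases h2.lt_or_eq with h' | h'
  · positivity
  exact absurd (Prod.ext h.symm h'.symm) hx

/-- An orthonormal pair for a multiple of `quad k`, starting in a given direction. -/
theorem exists_conjugate_pair {k l : ℝ} (hk : k ^ 2 < 1) (hl : 0 < l) {x : Plane}
    (hq : 0 < quad k x) :
    ∃ v : Plane, (∀ b : ℝ, l * quad k ((√(l * quad k x))⁻¹ • x + b • v) = 1 + b ^ 2) ∧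
      area ((√(l * quad k x))⁻¹ • x) v ^ 2 * (l ^ 2 * (1 - k ^ 2)) = 1 := by
  set r := √(1 - k ^ 2) with hr
  have hr0 : 0 < r := Real.sqrt_pos.2 (by linarith)
  have hr2 : r ^ 2 = 1 - k ^ 2 := Real.sq_sqrt (by linarith)
  set n := √(l * quad k x) with hn
  have hn0 : 0 < n := Real.sqrt_pos.2 (by positivity)
  have hn2 : n ^ 2 = l * quad k x := Real.sq_sqrt (by positivity)
  -- The vector `v` below is half the gradient of `quad k` at `u`, turned by a right angle and
  -- divided by `r`; thus it is conjugate to `u`.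
  set u : Plane := n⁻¹ • x with hu
  have hqu : l * quad k u = 1 := by
    rw [hu, quad_smul, inv_pow, hn2]
    field_simp
  refine ⟨(-(k * u.1 + u.2) / r, (u.1 + k * u.2) / r), fun b => ?_, ?_⟩
  · have : quad k (u + b • ((-(k * u.1 + u.2) / r, (u.1 + k * u.2) / r) : Plane)) =
        quad k u + b ^ 2 * ((1 - k ^ 2) * quad k u) / r ^ 2 := by
      simp only [quad, Prod.fst_add, Prod.snd_add, Prod.smul_fst, Prod.smul_snd, smul_eq_mul]
      field_simp
      ring
    rw [this, hr2, mul_add, hqu]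
    have h1 : 1 - k ^ 2 ≠ 0 := by linarith
    field_simp
    linear_combination b ^ 2 * hqu
  · have : area u (-(k * u.1 + u.2) / r, (u.1 + k * u.2) / r) = quad k u / r := by
      simp only [area, quad]
      field_simp
      ring
    rw [this, div_pow, ← hr2]
    field_simp
    rw [← mul_pow, mul_comm, hqu, one_pow]

theorem eventually_mem_quadrant {u : Plane} (h1 : 0 < u.1) (h2 : 0 < u.2) (v : Plane) :
    ∀ᶠ b : ℝ in 𝓝 0, 0 < (u + b • v).1 ∧ 0 < (u + b • v).2 := by
  have hc : Continuous fun b : ℝ => u + b • v := by fun_prop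
  have ho : IsOpen {z : Plane | 0 < z.1 ∧ 0 < z.2} :=
    (isOpen_lt continuous_const continuous_fst).inter (isOpen_lt continuous_const continuous_snd)
  exact hc.continuousAt.eventually (ho.mem_nhds (by simpa using ⟨h1, h2⟩))

theorem map_inv_sqrt_smul (N : Seminorm ℝ Plane) {x : Plane} {c : ℝ} (hc : 0 < c)
    (h : c = N x ^ 2) : N ((√c)⁻¹ • x) = 1 := by
  subst h
  have hx : N x ≠ 0 := by rintro h; simp [h] at hc
  rw [Real.sqrt_sq (apply_nonneg N x), map_smul_eq_mul, norm_inv,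
    Real.norm_of_nonneg (apply_nonneg N x), inv_mul_cancel₀ hx]

theorem exists_lower_of_touching {N : Seminorm ℝ Plane} {k l : ℝ} (hk : k ^ 2 < 1) (hl : 0 < l)
    {x : Plane} (h1 : 0 < x.1) (h2 : 0 < x.2) (hq : 0 < quad k x)
    (hx : l * quad k x = N x ^ 2)
    (hle : ∀ y : Plane, 0 < y.1 → 0 < y.2 → l * quad k y ≤ N y ^ 2) :
    ∃ u v, Lower N u v ∧ area u v ^ 2 * (l ^ 2 * (1 - k ^ 2)) = 1 := by
  obtain ⟨v, hv, ha⟩ := exists_conjugate_pair hk hl hq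
  have hn : 0 < (√(l * quad k x))⁻¹ := inv_pos.2 (Real.sqrt_pos.2 (by positivity))
  refine ⟨_, v, ⟨map_inv_sqrt_smul N (by positivity) hx, ?_⟩, ha⟩
  filter_upwards [eventually_mem_quadrant (u := (√(l * quad k x))⁻¹ • x)
    (by simpa using mul_pos hn h1) (by simpa using mul_pos hn h2) v] with b hb
  rw [← hv]
  exact hle _ hb.1 hb.2

theorem exists_upper_of_touching {M : Seminorm ℝ Plane} {k l : ℝ} (hk : k ^ 2 < 1) (hl : 0 < l)
    {x : Plane} (h1 : 0 < x.1) (h2 : 0 < x.2) (hq : 0 < quad k x)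
    (hx : l * quad k x = M x ^ 2)
    (hle : ∀ y : Plane, 0 < y.1 → 0 < y.2 → M y ^ 2 ≤ l * quad k y) :
    ∃ u v, Upper M u v ∧ area u v ^ 2 * (l ^ 2 * (1 - k ^ 2)) = 1 := by
  obtain ⟨v, hv, ha⟩ := exists_conjugate_pair hk hl hq
  have hn : 0 < (√(l * quad k x))⁻¹ := inv_pos.2 (Real.sqrt_pos.2 (by positivity))
  refine ⟨_, v, ⟨map_inv_sqrt_smul M (by positivity) hx, ?_⟩, ha⟩
  filter_upwards [eventually_mem_quadrant (u := (√(l * quad k x))⁻¹ • x)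
    (by simpa using mul_pos hn h1) (by simpa using mul_pos hn h2) v] with b hb
  rw [← hv]
  exact hle _ hb.1 hb.2

theorem le_at_zero_of_le_near {g h : ℝ → ℝ} (hg : Continuous g) (hh : Continuous h) {d : ℝ}
    (hd : 0 < d) (hle : ∀ t, 0 < t → t < d → g t ≤ h t) : g 0 ≤ h 0 := by
  refine le_of_tendsto_of_tendsto (hg.continuousAt.mono_left (nhdsWithin_le_nhds (s := Set.Ioi 0)))
    (hh.continuousAt.mono_left nhdsWithin_le_nhds) ?_
  filter_upwards [Ioo_mem_nhdsGT hd] with t ht using hle t ht.1 ht.2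

/-- A quotient of quadratically homogeneous functions attains its minimum on the quadrant. -/
theorem exists_min_ratio {f g : Plane → ℝ} (hf : Continuous f) (hg : Continuous g)
    (hfh : ∀ (t : ℝ) x, f (t • x) = t ^ 2 * f x) (hgh : ∀ (t : ℝ) x, g (t • x) = t ^ 2 * g x)
    (hg0 : ∀ x : Plane, 0 ≤ x.1 → 0 ≤ x.2 → x ≠ 0 → 0 < g x) :
    ∃ x : Plane, 0 ≤ x.1 ∧ 0 ≤ x.2 ∧ x.1 + x.2 = 1 ∧
      ∀ y : Plane, 0 ≤ y.1 → 0 ≤ y.2 → f x * g y ≤ f y * g x := by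
  have hpos : ∀ x : Plane, 0 ≤ x.1 → 0 ≤ x.2 → x.1 + x.2 = 1 → 0 < g x := fun x h1 h2 h3 =>
    hg0 x h1 h2 (by rintro rfl; simp at h3)
  have hK : IsCompact {x : Plane | 0 ≤ x.1 ∧ 0 ≤ x.2 ∧ x.1 + x.2 = 1} := by
    refine (isCompact_Icc (a := ((0, 0) : Plane)) (b := (1, 1))).of_isClosed_subset ?_ ?_
    · exact (isClosed_le continuous_const continuous_fst).inter
        ((isClosed_le continuous_const continuous_snd).inter
          (isClosed_eq (continuous_fst.add continuous_snd) continuous_const))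
    · rintro x ⟨h1, h2, h3⟩
      exact ⟨⟨h1, h2⟩, ⟨by simp only; linarith, by simp only; linarith⟩⟩
  obtain ⟨x, ⟨h1, h2, h3⟩, hmin⟩ := hK.exists_isMinOn ⟨(1, 0), by simp⟩
    (hf.continuousOn.div hg.continuousOn fun x hx => (hpos x hx.1 hx.2.1 hx.2.2).ne')
  refine ⟨x, h1, h2, h3, fun y hy1 hy2 => ?_⟩
  rcases (add_nonneg hy1 hy2).eq_or_lt with hy | hy
  · have : y = (0 : ℝ) • x := by ext <;> simp <;> linarith
    rw [this, hfh, hgh]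
    simp
  · have := hmin (show (y.1 + y.2)⁻¹ • y ∈ _ from
      ⟨by simp only [Prod.smul_fst, smul_eq_mul]; positivity,
        by simp only [Prod.smul_snd, smul_eq_mul]; positivity, by
          simp only [Prod.smul_fst, Prod.smul_snd, smul_eq_mul]; field_simp⟩)
    have hgy : 0 < g y := hg0 y hy1 hy2 (by rintro rfl; simp at hy)
    simp only [Set.mem_ofPred_eq, Pi.div_apply, hfh, hgh] at this
    rw [mul_div_mul_left _ _ (by positivity),
      div_le_div_iff₀ (hpos x h1 h2 h3) hgy] at this
    exact this

/-! ### Area bounds force comparison with a quadratic form -/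

theorem quad_add (c d : ℝ) (x : Plane) : quad (c + d) x = quad c x + 2 * d * (x.1 * x.2) := by
  simp only [quad]
  ring

theorem two_mul_le_quad {c : ℝ} (hc : 0 ≤ c) {x : Plane} (h1 : 0 ≤ x.1) (h2 : 0 ≤ x.2) :
    2 * (x.1 * x.2) ≤ quad c x := by
  have : 0 ≤ c * x.1 * x.2 := by positivity
  simp only [quad]
  nlinarith [sq_nonneg (x.1 - x.2)]

theorem interior_of_ratio_ne {N : Seminorm ℝ Plane} (hN1 : N (1, 0) = 1) (hN2 : N (0, 1) = 1)
    {c : ℝ} {x : Plane} (h1 : 0 ≤ x.1) (h2 : 0 ≤ x.2) (h3 : x.1 + x.2 = 1)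
    (hne : N x ^ 2 ≠ quad c x) : 0 < x.1 ∧ 0 < x.2 := by
  obtain ⟨a, b⟩ := x
  simp only at h1 h2 h3
  constructor
  · refine lt_of_le_of_ne h1 ?_
    rintro rfl
    obtain rfl : b = 1 := by linarith
    exact hne (by simp [hN2, quad])
  · refine lt_of_le_of_ne h2 ?_
    rintro rfl
    obtain rfl : a = 1 := by linarith
    exact hne (by simp [hN1, quad])

theorem continuous_sq_seminorm (N : Seminorm ℝ Plane) : Continuous fun x => N x ^ 2 :=
  (seminorm_continuous N).pow 2

theorem sq_seminorm_smul (N : Seminorm ℝ Plane) (t : ℝ) (x : Plane) :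
    N (t • x) ^ 2 = t ^ 2 * N x ^ 2 := by
  rw [map_smul_eq_mul, mul_pow, Real.norm_eq_abs, sq_abs]

/-- Let `c` be the largest coefficient in `[0, k]` with `quad c ≤ N²`. If `c < k`, a slightly larger
coefficient `c + d` fails, so the minimum `l` of `N² / quad (c + d)` is below 1 and is attained
inside the quadrant, the ratio being 1 on its edges. The ellipse of `l * quad (c + d)` touches there
and gives a `Lower` frame with squared area `1 / (l² (1 - (c + d)²)) ≥ D`. As `d → 0` this yields `D
(1 - c²) ≤ 1`, contradicting `c < k`. -/
theorem quad_le_sq {N : Seminorm ℝ Plane} (hN1 : N (1, 0) = 1) (hN2 : N (0, 1) = 1)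
    (hN0 : ∀ x : Plane, 0 ≤ x.1 → 0 ≤ x.2 → quad 0 x ≤ N x ^ 2) {D : ℝ}
    (hD : ∀ u v, area u v ≠ 0 → Lower N u v → D ≤ area u v ^ 2) {k : ℝ} (hk0 : 0 ≤ k)
    (hk1 : k < 1) (hDk : 1 ≤ D * (1 - k ^ 2)) :
    ∀ x : Plane, 0 ≤ x.1 → 0 ≤ x.2 → quad k x ≤ N x ^ 2 := by
  have hSc : IsCompact
      {c ∈ Set.Icc 0 k | ∀ x : Plane, 0 ≤ x.1 → 0 ≤ x.2 → quad c x ≤ N x ^ 2} := by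
    refine isCompact_Icc.of_isClosed_subset ?_ (fun t ht => ht.1)
    have hcl : IsClosed {c : ℝ | ∀ x : Plane, 0 ≤ x.1 → 0 ≤ x.2 → quad c x ≤ N x ^ 2} := by
      simp only [Set.ofPred_forall, quad]
      exact isClosed_iInter fun x => isClosed_iInter fun _ => isClosed_iInter fun _ =>
        isClosed_le (by fun_prop) continuous_const
    exact isClosed_Icc.inter hcl
  obtain ⟨c, ⟨⟨hc0, hck⟩, hcN⟩, hcmax⟩ := hSc.exists_isGreatest ⟨0, ⟨le_rfl, hk0⟩, hN0⟩
  rcases hck.eq_or_lt with rfl | hck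
  · exact hcN
  exfalso
  have key : ∀ d, 0 < d → d < k - c → D * (1 - (c + d) ^ 2) ≤ (1 + d) ^ 2 := by
    intro d hd0 hd
    have hcd0 : 0 ≤ c + d := by linarith
    have hcd1 : (c + d) ^ 2 < 1 := by nlinarith
    obtain ⟨x, h1, h2, h3, hx⟩ := exists_min_ratio (continuous_sq_seminorm N)
      (continuous_quad (c + d)) (sq_seminorm_smul N) (quad_smul (c + d))
      (fun x => quad_pos hcd0)
    have hqx : 0 < quad (c + d) x := quad_pos hcd0 h1 h2 (by rintro rfl; simp at h3)
    have hx0 : x ≠ 0 := by rintro rfl; simp at h3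
    have hNx : 0 < N x ^ 2 := (quad_pos hc0 h1 h2 hx0).trans_le (hcN x h1 h2)
    have hlt : N x ^ 2 < quad (c + d) x := by
      by_contra hge
      have : c + d ≤ c := hcmax ⟨⟨hcd0, by linarith⟩, fun y hy1 hy2 => by
        have h4 := hx y hy1 hy2
        rcases eq_or_ne y 0 with rfl | hy
        · simp [quad]
        have h5 := quad_pos hcd0 hy1 hy2 hy
        nlinarith⟩
      linarith
    obtain ⟨h1', h2'⟩ := interior_of_ratio_ne hN1 hN2 h1 h2 h3 hlt.ne
    have hl : 0 < N x ^ 2 / quad (c + d) x := by positivity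
    obtain ⟨u, v, huv, ha⟩ := exists_lower_of_touching hcd1 hl h1' h2' hqx
      (div_mul_cancel₀ _ hqx.ne') fun y hy1 hy2 => by
        rw [div_mul_eq_mul_div, div_le_iff₀ hqx]
        exact hx y hy1.le hy2.le
    have hDa := hD u v (by rintro h0; simp [h0] at ha) huv
    -- Since `2 x₁ x₂ ≤ quad c x`, the overshoot costs at most a factor `1 + d`.
    have hl1 : 1 ≤ N x ^ 2 / quad (c + d) x * (1 + d) := by
      rw [div_mul_eq_mul_div, le_div_iff₀ hqx, quad_add]
      nlinarith [hcN x h1 h2, two_mul_le_quad hc0 h1 h2]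
    generalize N x ^ 2 / quad (c + d) x = l at hl ha hl1
    have hp : 0 ≤ l ^ 2 * (1 - (c + d) ^ 2) := mul_nonneg (sq_nonneg l) (by linarith)
    have h6 : D * (l ^ 2 * (1 - (c + d) ^ 2)) ≤ 1 :=
      (mul_le_mul_of_nonneg_right hDa hp).trans_eq ha
    have h7 : 1 ≤ (l * (1 + d)) ^ 2 := one_le_pow₀ hl1
    have hD0 : 0 < D := by
      by_contra hneg
      nlinarith [mul_nonneg (neg_nonneg.2 (not_lt.1 hneg)) (show 0 ≤ 1 - k ^ 2 by nlinarith)]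
    have h8 : 0 ≤ D * (1 - (c + d) ^ 2) := mul_nonneg hD0.le (by linarith)
    calc D * (1 - (c + d) ^ 2) ≤ D * (1 - (c + d) ^ 2) * (l * (1 + d)) ^ 2 :=
          le_mul_of_one_le_right h8 h7
      _ = D * (l ^ 2 * (1 - (c + d) ^ 2)) * (1 + d) ^ 2 := by ring
      _ ≤ 1 * (1 + d) ^ 2 := by gcongr
      _ = _ := one_mul _
  have := le_at_zero_of_le_near (g := fun d => D * (1 - (c + d) ^ 2)) (h := fun d => (1 + d) ^ 2)
    (by fun_prop) (by fun_prop) (sub_pos.2 hck) key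
  simp only [add_zero, one_pow] at this
  have hD0 : 0 < D := by
    by_contra hneg
    nlinarith [mul_nonneg (neg_nonneg.2 (not_lt.1 hneg)) (show 0 ≤ 1 - k ^ 2 by nlinarith)]
  nlinarith [mul_pos hD0 (show 0 < k ^ 2 - c ^ 2 by nlinarith)]

/-- The mirror image of `quad_le_sq`: the coefficient decreases from 1, where the bound is the
triangle inequality, and maximal ratios give `Upper` frames. -/
theorem sq_le_quad {M : Seminorm ℝ Plane} (hM1 : M (1, 0) = 1) (hM2 : M (0, 1) = 1) {D : ℝ}
    (hD : ∀ u v, Upper M u v → area u v ^ 2 ≤ D) {k : ℝ} (hk0 : 0 ≤ k)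
    (hk1 : k < 1) (hDk : D * (1 - k ^ 2) ≤ 1) :
    ∀ x : Plane, 0 ≤ x.1 → 0 ≤ x.2 → M x ^ 2 ≤ quad k x := by
  have hSc : IsCompact
      {c ∈ Set.Icc k 1 | ∀ x : Plane, 0 ≤ x.1 → 0 ≤ x.2 → M x ^ 2 ≤ quad c x} := by
    refine isCompact_Icc.of_isClosed_subset ?_ (fun t ht => ht.1)
    have hcl : IsClosed {c : ℝ | ∀ x : Plane, 0 ≤ x.1 → 0 ≤ x.2 → M x ^ 2 ≤ quad c x} := by
      simp only [Set.ofPred_forall, quad]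
      exact isClosed_iInter fun x => isClosed_iInter fun _ => isClosed_iInter fun _ =>
        isClosed_le continuous_const (by fun_prop)
    exact isClosed_Icc.inter hcl
  have hM0 : ∀ x : Plane, 0 ≤ x.1 → 0 ≤ x.2 → M x ^ 2 ≤ quad 1 x := by
    intro x h1 h2
    have : M x ≤ x.1 + x.2 := by
      calc M x = M (x.1 • ((1, 0) : Plane) + x.2 • ((0, 1) : Plane)) := by simp
        _ ≤ M (x.1 • ((1, 0) : Plane)) + M (x.2 • ((0, 1) : Plane)) := map_add_le_add M _ _
        _ = _ := by
          rw [map_smul_eq_mul, map_smul_eq_mul, hM1, hM2, Real.norm_of_nonneg h1,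
            Real.norm_of_nonneg h2, mul_one, mul_one]
    calc M x ^ 2 ≤ (x.1 + x.2) ^ 2 := pow_le_pow_left₀ (apply_nonneg M x) this 2
      _ = _ := by simp only [quad]; ring
  obtain ⟨c, ⟨⟨hkc, hc1⟩, hcM⟩, hcmin⟩ := hSc.exists_isLeast ⟨1, ⟨hk1.le, le_rfl⟩, hM0⟩
  rcases hkc.eq_or_lt with rfl | hkc
  · exact hcM
  exfalso
  have key : ∀ d, 0 < d → d < c - k → 1 ≤ D * (1 - (c - d) ^ 2) * (1 + d) ^ 2 := by
    intro d hd0 hd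
    have hcd0 : 0 ≤ c - d := by linarith
    have hcd1 : (c - d) ^ 2 < 1 := by nlinarith
    obtain ⟨x, h1, h2, h3, hx⟩ := exists_min_ratio (f := fun x => -(M x ^ 2))
      (continuous_sq_seminorm M).neg (continuous_quad (c - d))
      (fun t x => by rw [sq_seminorm_smul]; ring) (quad_smul (c - d)) (fun x => quad_pos hcd0)
    simp only [neg_mul, neg_le_neg_iff] at hx
    have hx0 : x ≠ 0 := by rintro rfl; simp at h3
    have hqx : 0 < quad (c - d) x := quad_pos hcd0 h1 h2 hx0
    have hlt : quad (c - d) x < M x ^ 2 := by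
      by_contra hge
      have : c ≤ c - d := hcmin ⟨⟨by linarith, by linarith⟩, fun y hy1 hy2 => by
        have h4 := hx y hy1 hy2
        rcases eq_or_ne y 0 with rfl | hy
        · simp [quad]
        have h5 := quad_pos hcd0 hy1 hy2 hy
        nlinarith⟩
      linarith
    obtain ⟨h1', h2'⟩ := interior_of_ratio_ne hM1 hM2 h1 h2 h3 hlt.ne'
    have hl : 0 < M x ^ 2 / quad (c - d) x := div_pos (hqx.trans hlt) hqx
    obtain ⟨u, v, huv, ha⟩ := exists_upper_of_touching hcd1 hl h1' h2' hqx
      (div_mul_cancel₀ _ hqx.ne') fun y hy1 hy2 => by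
        rw [div_mul_eq_mul_div, le_div_iff₀ hqx]
        exact hx y hy1.le hy2.le
    have hDa := hD u v huv
    have hl1 : M x ^ 2 / quad (c - d) x ≤ 1 + d := by
      have h4 := quad_add (c - d) d x
      rw [sub_add_cancel] at h4
      rw [div_le_iff₀ hqx]
      nlinarith [hcM x h1 h2, two_mul_le_quad hcd0 h1 h2]
    generalize M x ^ 2 / quad (c - d) x = l at hl ha hl1
    have hp : 0 ≤ l ^ 2 * (1 - (c - d) ^ 2) := mul_nonneg (sq_nonneg l) (by linarith)
    have hD0 : 0 ≤ D := (sq_nonneg _).trans hDa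
    have h8 : 0 ≤ D * (1 - (c - d) ^ 2) := mul_nonneg hD0 (by linarith)
    calc 1 = area u v ^ 2 * (l ^ 2 * (1 - (c - d) ^ 2)) := ha.symm
      _ ≤ D * (l ^ 2 * (1 - (c - d) ^ 2)) := mul_le_mul_of_nonneg_right hDa hp
      _ = D * (1 - (c - d) ^ 2) * l ^ 2 := by ring
      _ ≤ _ := by gcongr
  have := le_at_zero_of_le_near (g := fun _ => 1)
    (h := fun d => D * (1 - (c - d) ^ 2) * (1 + d) ^ 2)
    (by fun_prop) (by fun_prop) (sub_pos.2 hkc) key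
  simp only [sub_zero, add_zero, one_pow, mul_one] at this
  have hD0 : 0 < D := by
    by_contra hneg
    nlinarith [mul_nonneg (neg_nonneg.2 (not_lt.1 hneg)) (show 0 ≤ 1 - c ^ 2 by nlinarith)]
  nlinarith [mul_pos hD0 (show 0 < c ^ 2 - k ^ 2 by nlinarith)]

/-- When the two unit vectors are close, the triangle inequality alone gives the starting form of
`quad_le_sq`. -/
theorem quad_zero_le_sq_of_close {N : Seminorm ℝ Plane} (hN1 : N (1, 0) = 1) (hN2 : N (0, 1) = 1)
    (hcl : N (1, -1) ≤ 1 / 2) (x : Plane) (h1 : 0 ≤ x.1) (h2 : 0 ≤ x.2) :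
    quad 0 x ≤ N x ^ 2 := by
  have hA : x.1 + x.2 / 2 ≤ N x := by
    have h3 : (x.1 + x.2) • ((1, 0) : Plane) = x + x.2 • ((1, -1) : Plane) := by
      ext <;> simp
    have h4 := map_add_le_add N x (x.2 • ((1, -1) : Plane))
    rw [← h3, map_smul_eq_mul, map_smul_eq_mul, hN1, Real.norm_of_nonneg h2,
      Real.norm_of_nonneg (add_nonneg h1 h2)] at h4
    nlinarith
  have hB : x.1 / 2 + x.2 ≤ N x := by
    have h3 : (x.1 + x.2) • ((0, 1) : Plane) = x - x.1 • ((1, -1) : Plane) := by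
      ext <;> simp [add_comm]
    have h4 := map_sub_le_add N x (x.1 • ((1, -1) : Plane))
    rw [← h3, map_smul_eq_mul, map_smul_eq_mul, hN2, Real.norm_of_nonneg h1,
      Real.norm_of_nonneg (add_nonneg h1 h2)] at h4
    nlinarith
  simp only [quad, mul_zero, zero_mul, add_zero]
  rcases le_total x.1 x.2 with h | h <;> nlinarith [mul_nonneg h1 h2]

/-! ### Prolonging a circular arc -/

theorem lower_comp {N : Seminorm ℝ Plane} {p q u v : Plane} :
    Lower (N.comp (frame p q)) u v ↔ Lower N (frame p q u) (frame p q v) := by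
  simp [Lower]

theorem upper_comp {N : Seminorm ℝ Plane} {p q u v : Plane} :
    Upper (N.comp (frame p q)) u v ↔ Upper N (frame p q u) (frame p q v) := by
  simp [Upper]

theorem lower_bound_comp {N : Seminorm ℝ Plane} {D : ℝ}
    (hD : ∀ u v, area u v ≠ 0 → Lower N u v → D ≤ area u v ^ 2) {p q : Plane}
    (hpq : area p q ≠ 0) :
    ∀ u v, area u v ≠ 0 → Lower (N.comp (frame p q)) u v →
      D / area p q ^ 2 ≤ area u v ^ 2 := by
  intro u v huv hl
  have := hD _ _ (by rw [area_frame]; exact mul_ne_zero huv hpq) (lower_comp.1 hl)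
  rw [area_frame, mul_pow] at this
  rwa [div_le_iff₀ (by positivity)]

theorem upper_bound_comp {M : Seminorm ℝ Plane} {D : ℝ}
    (hD : ∀ u v, Upper M u v → area u v ^ 2 ≤ D) {p q : Plane} (hpq : area p q ≠ 0) :
    ∀ u v, Upper (M.comp (frame p q)) u v → area u v ^ 2 ≤ D / area p q ^ 2 := by
  intro u v hl
  have := hD _ _ (upper_comp.1 hl)
  rw [area_frame, mul_pow] at this
  rwa [le_div_iff₀ (by positivity)]

theorem quad_expand (k X n t : ℝ) {Y : ℝ} (hY : Y ≠ 0) :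
    quad k (1 - t * (X / Y), t * (n / Y)) = 1 + t * (2 * (k * n - X) / Y +
      t * (X ^ 2 / Y ^ 2 - 2 * k * X * n / Y ^ 2 + n ^ 2 / Y ^ 2)) := by
  simp only [quad]
  field_simp
  ring

theorem frame_normalized {x : Plane} {n : ℝ} (hx : x.2 ≠ 0) (hn : n ≠ 0) (t : ℝ) :
    frame (1, 0) (n⁻¹ • x) (1 - t * (x.1 / x.2), t * (n / x.2)) = (1, t) := by
  ext
  · simp only [frame_apply, Prod.fst_add, Prod.smul_fst, smul_eq_mul]
    field_simp
    ring
  · simp only [frame_apply, Prod.snd_add, Prod.smul_snd, smul_eq_mul]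
    field_simp
    ring

theorem exists_small {P : ℝ → Prop} (h : ∀ᶠ t in 𝓝 (0 : ℝ), P t) (c : ℝ) :
    ∃ d > 0, ∀ t, 0 < t → t < d → P t ∧ 0 ≤ 1 - t * c := by
  have h2 : ∀ᶠ t in 𝓝 (0 : ℝ), 0 < 1 - t * c :=
    (show Continuous fun t : ℝ => 1 - t * c by fun_prop).continuousAt.eventually_const_lt (by simp)
  obtain ⟨d, hd, hd'⟩ := Metric.eventually_nhds_iff.1 (h.and h2)
  refine ⟨d, hd, fun t ht0 ht => ?_⟩
  have := hd' (y := t) (by rwa [dist_zero_right, Real.norm_of_nonneg ht0.le])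
  exact ⟨this.1, this.2.le⟩

theorem area_one_zero_smul (c : ℝ) (x : Plane) : area (1, 0) (c • x) = c * x.2 := by
  simp [area]

/-- Apply `quad_le_sq` in the sector between `(1, 0)` and the normalized `x`. The form and `N²`
agree at `(1, 0)`, near which `N` is Euclidean, so comparing first derivatives there bounds `N x`.
-/
theorem sq_le_of_lower_bound {N : Seminorm ℝ Plane} (hN : Definite N) (hN1 : N (1, 0) = 1)
    (hloc : ∀ᶠ t : ℝ in 𝓝 0, N (1, t) ^ 2 = 1 + t ^ 2)
    (hD : ∀ u v, area u v ≠ 0 → Lower N u v → 1 ≤ area u v ^ 2) {x : Plane} (hx1 : 0 ≤ x.1)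
    (hx2 : 0 < x.2) (hcl : N ((1, 0) - x) ≤ 1 / 4) : N x ^ 2 ≤ x.1 ^ 2 + x.2 ^ 2 := by
  have hn : 0 < N x := hN.pos (by rintro rfl; simp at hx2)
  set n := N x with hndef
  rcases le_or_gt n x.2 with hle | hlt
  · nlinarith
  have ha : area (1, 0) (n⁻¹ • x) = n⁻¹ * x.2 := area_one_zero_smul _ _
  have hane : area (1, 0) (n⁻¹ • x) ≠ 0 := by rw [ha]; positivity
  have hq1 : (N.comp (frame (1, 0) (n⁻¹ • x))) (1, 0) = 1 := by simpa using hN1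
  have hq2 : (N.comp (frame (1, 0) (n⁻¹ • x))) (0, 1) = 1 := by
    rw [Seminorm.comp_apply, frame_zero_one, map_smul_eq_mul, Real.norm_of_nonneg (by positivity),
      inv_mul_cancel₀ hn.ne']
  have hclose : (N.comp (frame (1, 0) (n⁻¹ • x))) (1, -1) ≤ 1 / 2 := by
    rw [Seminorm.comp_apply, frame_mk]
    have h1 : (1 : ℝ) • ((1, 0) : Plane) + (-1 : ℝ) • n⁻¹ • x =
        ((1, 0) - x) + (1 - n⁻¹) • x := by module
    have h2 := map_add_le_add N ((1, 0) - x) ((1 - n⁻¹) • x)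
    have h3 : N ((1 - n⁻¹) • x) = |n - 1| := by
      rw [map_smul_eq_mul, ← hndef, Real.norm_eq_abs, ← abs_of_pos hn, ← abs_mul, abs_of_pos hn,
        sub_mul, inv_mul_cancel₀ hn.ne', one_mul]
    have h4 : |n - 1| ≤ N ((1, 0) - x) := by
      have := abs_sub_map_le_sub N (1, 0) x
      rwa [hN1, abs_sub_comm] at this
    rw [h1]
    linarith
  have hr1 : x.2 ^ 2 / n ^ 2 < 1 := by
    rw [div_lt_one (by positivity)]
    nlinarith
  have hr0 : 0 < x.2 ^ 2 / n ^ 2 := by positivity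
  -- This `k` gives equality in the area condition, as the frame has squared area `x.2 ^ 2 / n ^ 2`.
  set k := √(1 - x.2 ^ 2 / n ^ 2)
  have hk2 : k ^ 2 = 1 - x.2 ^ 2 / n ^ 2 := Real.sq_sqrt (by linarith)
  have hk0 : 0 ≤ k := Real.sqrt_nonneg _
  have hq := quad_le_sq hq1 hq2 (quad_zero_le_sq_of_close hq1 hq2 hclose)
    (lower_bound_comp hD hane) hk0 (by nlinarith) (by
      rw [hk2, ha]
      have := hx2.ne'
      field_simp
      simp)
  obtain ⟨d, hd, hdt⟩ := exists_small hloc (x.1 / x.2)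
  have := le_at_zero_of_le_near (h := fun t => t)
    (g := fun t => 2 * (k * n - x.1) / x.2 + t * (x.1 ^ 2 / x.2 ^ 2 - 2 * k * x.1 * n / x.2 ^ 2
      + n ^ 2 / x.2 ^ 2)) (by fun_prop) (by fun_prop) hd fun t ht0 htd => by
      obtain ⟨h1, h2⟩ := hdt t ht0 htd
      have h3 := hq (1 - t * (x.1 / x.2), t * (n / x.2)) h2 (by simp only; positivity)
      rw [Seminorm.comp_apply, frame_normalized hx2.ne' hn.ne', h1,
        quad_expand _ _ _ _ hx2.ne'] at h3
      have h4 : t * (2 * (k * n - x.1) / x.2 + t * (x.1 ^ 2 / x.2 ^ 2 - 2 * k * x.1 * n / x.2 ^ 2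
        + n ^ 2 / x.2 ^ 2)) ≤ t * t := by linarith
      exact le_of_mul_le_mul_left h4 ht0
  simp only [zero_mul, add_zero] at this
  rw [div_le_iff₀ hx2, zero_mul] at this
  have h5 : (k * n) ^ 2 = n ^ 2 - x.2 ^ 2 := by
    rw [mul_pow, hk2]
    field_simp
  have h6 : (k * n) ^ 2 ≤ x.1 ^ 2 := pow_le_pow_left₀ (by positivity) (by linarith) 2
  linarith

/-- The first-derivative argument of `sq_le_of_lower_bound` with `sq_le_quad`; no closeness is
needed, because that comparison starts from the triangle inequality. -/
theorem le_sq_of_upper_bound {M : Seminorm ℝ Plane} (hM : Definite M) (hM1 : M (1, 0) = 1)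
    (hloc : ∀ᶠ t : ℝ in 𝓝 0, M (1, t) ^ 2 = 1 + t ^ 2)
    (hD : ∀ u v, Upper M u v → area u v ^ 2 ≤ 1) {x : Plane} (hx1 : 0 < x.1)
    (hx2 : 0 < x.2) : x.1 ^ 2 + x.2 ^ 2 ≤ M x ^ 2 := by
  have hn : 0 < M x := hM.pos (by rintro rfl; simp at hx2)
  set n := M x with hndef
  have ha : area (1, 0) (n⁻¹ • x) = n⁻¹ * x.2 := area_one_zero_smul _ _
  have hane : area (1, 0) (n⁻¹ • x) ≠ 0 := by rw [ha]; positivity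
  have hq1 : (M.comp (frame (1, 0) (n⁻¹ • x))) (1, 0) = 1 := by simpa using hM1
  have hq2 : (M.comp (frame (1, 0) (n⁻¹ • x))) (0, 1) = 1 := by
    rw [Seminorm.comp_apply, frame_zero_one, map_smul_eq_mul, Real.norm_of_nonneg (by positivity),
      inv_mul_cancel₀ hn.ne']
  have slope : ∀ k : ℝ, 0 ≤ k → k < 1 → 1 / area (1, 0) (n⁻¹ • x) ^ 2 * (1 - k ^ 2) ≤ 1 →
      x.1 ≤ k * n := by
    intro k hk0 hk1 hDk
    have hq := sq_le_quad hq1 hq2 (upper_bound_comp hD hane) hk0 hk1 hDk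
    obtain ⟨d, hd, hdt⟩ := exists_small hloc (x.1 / x.2)
    have := le_at_zero_of_le_near (g := fun t => t)
      (h := fun t => 2 * (k * n - x.1) / x.2 + t * (x.1 ^ 2 / x.2 ^ 2 -
        2 * k * x.1 * n / x.2 ^ 2 + n ^ 2 / x.2 ^ 2))
      (by fun_prop) (by fun_prop) hd fun t ht0 htd => by
        obtain ⟨h1, h2⟩ := hdt t ht0 htd
        have h3 := hq (1 - t * (x.1 / x.2), t * (n / x.2)) h2 (by simp only; positivity)
        rw [Seminorm.comp_apply, frame_normalized hx2.ne' hn.ne', h1,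
          quad_expand _ _ _ _ hx2.ne'] at h3
        have h4 : t * t ≤ t * (2 * (k * n - x.1) / x.2 + t * (x.1 ^ 2 / x.2 ^ 2 -
          2 * k * x.1 * n / x.2 ^ 2 + n ^ 2 / x.2 ^ 2)) := by linarith
        exact le_of_mul_le_mul_left h4 ht0
    simp only [zero_mul, add_zero] at this
    rw [le_div_iff₀ hx2, zero_mul] at this
    linarith
  rcases lt_or_ge n x.2 with hlt | hge
  -- Here `1 - x.2 ^ 2 / n ^ 2` is negative; already `k = 0` is admissible and gives `x.1 ≤ 0`.
  · exfalso
    have := slope 0 le_rfl zero_lt_one (by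
      rw [ha, inv_mul_eq_div, div_pow, one_div_div, div_mul_eq_mul_div, div_le_one (by positivity)]
      nlinarith)
    linarith
  have hr1 : x.2 ^ 2 / n ^ 2 ≤ 1 := by
    rw [div_le_one (by positivity)]
    nlinarith
  have hr0 : 0 < x.2 ^ 2 / n ^ 2 := by positivity
  set k := √(1 - x.2 ^ 2 / n ^ 2)
  have hk2 : k ^ 2 = 1 - x.2 ^ 2 / n ^ 2 := Real.sq_sqrt (by linarith)
  have hk0 : 0 ≤ k := Real.sqrt_nonneg _
  have := slope k hk0 (by nlinarith) (by
      rw [hk2, ha]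
      have := hx2.ne'
      field_simp
      simp)
  have h5 : (k * n) ^ 2 = n ^ 2 - x.2 ^ 2 := by
    rw [mul_pow, hk2]
    field_simp
  have h6 : x.1 ^ 2 ≤ (k * n) ^ 2 := pow_le_pow_left₀ hx1.le this 2
  linarith

/-- The point of the Euclidean unit circle with angle `θ`. -/
noncomputable def circlePoint (θ : ℝ) : Plane := (Real.cos θ, Real.sin θ)

theorem seminorm_le_mul_norm (N : Seminorm ℝ Plane) (x : Plane) :
    N x ≤ (N (1, 0) + N (0, 1)) * ‖x‖ := by
  calc N x = N (x.1 • ((1, 0) : Plane) + x.2 • ((0, 1) : Plane)) := by simp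
    _ ≤ N (x.1 • ((1, 0) : Plane)) + N (x.2 • ((0, 1) : Plane)) := map_add_le_add N _ _
    _ = ‖x.1‖ * N (1, 0) + ‖x.2‖ * N (0, 1) := by rw [map_smul_eq_mul, map_smul_eq_mul]
    _ ≤ ‖x‖ * N (1, 0) + ‖x‖ * N (0, 1) := by
      gcongr
      · exact norm_fst_le x
      · exact norm_snd_le x
    _ = _ := by ring

theorem norm_circlePoint_sub_le (θ φ : ℝ) : ‖circlePoint θ - circlePoint φ‖ ≤ |θ - φ| :=
  max_le (Real.abs_cos_sub_cos_le θ φ) (Real.abs_sin_sub_sin_le θ φ)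

/-- A rotation through `θ`, preceded by a reflection if `e = -1`. -/
noncomputable def orthoFrame (θ e : ℝ) : Plane →ₗ[ℝ] Plane :=
  frame (circlePoint θ) (-(e * Real.sin θ), e * Real.cos θ)

theorem orthoFrame_circlePoint (θ φ : ℝ) {e : ℝ} (he : e = 1 ∨ e = -1) :
    orthoFrame θ e (circlePoint φ) = circlePoint (θ + e * φ) := by
  rcases he with rfl | rfl <;> ext <;>
    simp [orthoFrame, frame_apply, circlePoint, Real.cos_add, Real.sin_add] <;> ring

theorem orthoFrame_one (θ t : ℝ) {e : ℝ} (he : e = 1 ∨ e = -1) :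
    orthoFrame θ e (1, t) = √(1 + t ^ 2) • circlePoint (θ + e * Real.arctan t) := by
  rw [← orthoFrame_circlePoint θ _ he, ← map_smul]
  have : 0 < √(1 + t ^ 2) := Real.sqrt_pos.2 (by positivity)
  congr 1
  ext <;> simp only [circlePoint, Real.cos_arctan, Real.sin_arctan, Prod.smul_fst, Prod.smul_snd,
    smul_eq_mul] <;> field_simp

theorem area_orthoFrame_sq (θ : ℝ) {e : ℝ} (he : e = 1 ∨ e = -1) :
    area (circlePoint θ) (-(e * Real.sin θ), e * Real.cos θ) ^ 2 = 1 := by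
  have := Real.cos_sq_add_sin_sq θ
  have h : area (circlePoint θ) (-(e * Real.sin θ), e * Real.cos θ) = e := by
    simp only [area, circlePoint]
    linear_combination e * this
  rw [h]
  rcases he with rfl | rfl <;> norm_num

/-- The two one-sided estimates squeeze `1 ≤ M ≤ N ≤ 1`. The admissible angle depends only on `N`,
not on `θ`, which makes the prolongation repeatable. -/
theorem circle_extension {N M : Seminorm ℝ Plane} (hN : Definite N) (hM : Definite M)
    (hMN : ∀ x, M x ≤ N x)
    (hl : ∀ u v, area u v ≠ 0 → Lower N u v → 1 ≤ area u v ^ 2)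
    (hu : ∀ u v, Upper M u v → area u v ^ 2 ≤ 1) {θ : ℝ}
    (hθ : ∀ᶠ φ in 𝓝 θ, N (circlePoint φ) = 1 ∧ M (circlePoint φ) = 1) {φ : ℝ}
    (h1 : |φ - θ| < 1) (hφ : (N (1, 0) + N (0, 1)) * |φ - θ| ≤ 1 / 4) :
    N (circlePoint φ) = 1 ∧ M (circlePoint φ) = 1 := by
  rcases eq_or_ne φ θ with rfl | hne
  · exact hθ.self_of_nhds
  -- The sign `e` reflects the picture so that only prolongation in the positive direction has to be
  -- treated.
  obtain ⟨e, he, hs⟩ : ∃ e : ℝ, (e = 1 ∨ e = -1) ∧ φ = θ + e * |φ - θ| := by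
    rcases abs_choice (φ - θ) with h | h
    · exact ⟨1, Or.inl rfl, by rw [h]; ring⟩
    · exact ⟨-1, Or.inr rfl, by rw [h]; ring⟩
  have hs0 : 0 < |φ - θ| := abs_pos.2 (sub_ne_zero.2 hne)
  set s := |φ - θ| with hsdef
  have hA := area_orthoFrame_sq θ he
  have hA0 : area (circlePoint θ) (-(e * Real.sin θ), e * Real.cos θ) ≠ 0 := by
    rintro h; simp [h] at hA
  have hx : orthoFrame θ e (circlePoint s) = circlePoint φ := by
    rw [orthoFrame_circlePoint _ _ he, ← hs]
  have hone : orthoFrame θ e (1, 0) = circlePoint θ := by simp [orthoFrame]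
  have hloc : ∀ P : Seminorm ℝ Plane, (∀ᶠ φ in 𝓝 θ, P (circlePoint φ) = 1) →
      ∀ᶠ t : ℝ in 𝓝 0, (P.comp (orthoFrame θ e)) (1, t) ^ 2 = 1 + t ^ 2 := by
    intro P hP
    have hc : Tendsto (fun t => θ + e * Real.arctan t) (𝓝 0) (𝓝 θ) := by
      have : Continuous fun t => θ + e * Real.arctan t := by
        have := Real.continuous_arctan
        fun_prop
      simpa using this.tendsto 0
    filter_upwards [hc.eventually hP] with t ht
    rw [Seminorm.comp_apply, orthoFrame_one _ _ he, map_smul_eq_mul, ht, mul_one,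
      Real.norm_of_nonneg (Real.sqrt_nonneg _), Real.sq_sqrt (by positivity)]
  have hcos : 0 < (circlePoint s).1 :=
    Real.cos_pos_of_mem_Ioo ⟨by linarith [Real.pi_gt_three], by linarith [Real.pi_gt_three]⟩
  have hsin : 0 < (circlePoint s).2 :=
    Real.sin_pos_of_pos_of_lt_pi hs0 (by linarith [Real.pi_gt_three])
  have hN' := sq_le_of_lower_bound (N := N.comp (orthoFrame θ e)) (hN.comp hA0)
    (by rw [Seminorm.comp_apply, hone]; exact hθ.self_of_nhds.1)
    (hloc N (hθ.mono fun _ h => h.1))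
    (by simpa only [orthoFrame, hA, div_one] using lower_bound_comp hl hA0) hcos.le hsin (by
      rw [Seminorm.comp_apply, map_sub, hx, hone]
      refine (seminorm_le_mul_norm N _).trans (le_trans ?_ hφ)
      have := norm_circlePoint_sub_le θ φ
      rw [abs_sub_comm] at this
      gcongr)
  have hM' := le_sq_of_upper_bound (M := M.comp (orthoFrame θ e)) (hM.comp hA0)
    (by rw [Seminorm.comp_apply, hone]; exact hθ.self_of_nhds.2)
    (hloc M (hθ.mono fun _ h => h.2))
    (by simpa only [orthoFrame, hA, div_one] using upper_bound_comp hu hA0) hcos hsin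
  rw [Seminorm.comp_apply, hx, show (circlePoint s).1 ^ 2 + (circlePoint s).2 ^ 2 = 1 from
    Real.cos_sq_add_sin_sq s] at hN' hM'
  have h2 : N (circlePoint φ) ≤ 1 := by
    nlinarith [apply_nonneg N (circlePoint φ)]
  have h3 : 1 ≤ M (circlePoint φ) := by
    nlinarith [apply_nonneg M (circlePoint φ)]
  have h4 := hMN (circlePoint φ)
  exact ⟨by linarith, by linarith⟩

/-- A uniform prolongation angle makes the set of good angles both open and closed. -/
theorem sq_eq_of_local {N M : Seminorm ℝ Plane} (hN : Definite N) (hM : Definite M)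
    (hMN : ∀ x, M x ≤ N x)
    (hl : ∀ u v, area u v ≠ 0 → Lower N u v → 1 ≤ area u v ^ 2)
    (hu : ∀ u v, Upper M u v → area u v ^ 2 ≤ 1)
    (hloc : ∃ θ, ∀ᶠ φ in 𝓝 θ, N (circlePoint φ) = 1 ∧ M (circlePoint φ) = 1) (x : Plane) :
    M x ^ 2 = x.1 ^ 2 + x.2 ^ 2 := by
  set G := {θ | ∀ᶠ φ in 𝓝 θ, N (circlePoint φ) = 1 ∧ M (circlePoint φ) = 1} with hG
  set C := N (1, 0) + N (0, 1) with hC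
  have hC0 : 0 < C := add_pos (hN.pos (by simp)) (hN.pos (by simp))
  obtain ⟨r, hr0, hr⟩ : ∃ r > 0, ∀ θ ∈ G, ∀ φ, |φ - θ| < r → φ ∈ G := by
    refine ⟨min 1 (1 / 4 / C), by positivity, fun θ hθ φ hφ => ?_⟩
    have : ∀ᶠ ψ in 𝓝 φ, |ψ - θ| < min 1 (1 / 4 / C) :=
      (show Continuous fun ψ : ℝ => |ψ - θ| by fun_prop).continuousAt.eventually_lt_const hφ
    filter_upwards [this] with ψ hψ
    obtain ⟨h1, h2⟩ := lt_min_iff.1 hψ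
    rw [lt_div_iff₀ hC0, mul_comm] at h2
    exact circle_extension hN hM hMN hl hu hθ h1 h2.le
  have hclopen : IsClopen G := by
    refine ⟨isOpen_compl_iff.1 (Metric.isOpen_iff.2 fun φ hφ => ⟨r, hr0, fun ψ hψ h => ?_⟩),
      Metric.isOpen_iff.2 fun θ hθ => ⟨r, hr0, fun ψ hψ => hr θ hθ ψ hψ⟩⟩
    exact hφ (hr ψ h φ (by rwa [abs_sub_comm]))
  have huniv : G = Set.univ := hclopen.eq_univ hloc
  have hM1 : ∀ θ, M (circlePoint θ) = 1 := fun θ => by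
    have : θ ∈ G := huniv ▸ Set.mem_univ θ
    exact (Filter.Eventually.self_of_nhds this).2
  set z : ℂ := ⟨x.1, x.2⟩
  have hx : x = ‖z‖ • circlePoint z.arg := by
    ext
    · exact (Complex.norm_mul_cos_arg z).symm
    · exact (Complex.norm_mul_sin_arg z).symm
  rw [hx, sq_seminorm_smul, hM1]
  simp only [circlePoint, Prod.smul_fst, Prod.smul_snd, smul_eq_mul]
  linear_combination -‖z‖ ^ 2 * Real.cos_sq_add_sin_sq z.arg

/-! ### Existence of osculating ellipses and the separating area -/

theorem quad_zero_pos {x : Plane} (hx : x ≠ 0) : 0 < quad 0 x := by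
  have : quad 0 x = x.1 ^ 2 + x.2 ^ 2 := by simp [quad]
  rw [this]
  by_contra h
  refine hx (Prod.ext ?_ ?_) <;> simp only [Prod.fst_zero, Prod.snd_zero] <;> nlinarith

/-- A quadratically homogeneous function attains its minimum on the Euclidean circle. -/
theorem exists_min_ratio_circle {f : Plane → ℝ} (hf : Continuous f)
    (hfh : ∀ (t : ℝ) x, f (t • x) = t ^ 2 * f x) :
    ∃ x : Plane, x ≠ 0 ∧ ∀ y, f x * quad 0 y ≤ f y * quad 0 x := by
  have hne : ∀ x ∈ Metric.sphere (0 : Plane) 1, x ≠ 0 := by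
    rintro x hx rfl; simp at hx
  obtain ⟨x, hx, hmin⟩ := (isCompact_sphere (0 : Plane) 1).exists_isMinOn
    ((NormedSpace.sphere_nonempty (x := (0 : Plane))).2 zero_le_one)
    (hf.continuousOn.div (continuous_quad 0).continuousOn fun x hx => (quad_zero_pos (hne x hx)).ne')
  refine ⟨x, hne x hx, fun y => ?_⟩
  rcases eq_or_ne y 0 with rfl | hy
  · have := hfh 0 0
    simp only [zero_smul] at this
    rw [this]
    simp [quad]
  have hy' : 0 < ‖y‖ := norm_pos_iff.2 hy
  have := hmin (show ‖y‖⁻¹ • y ∈ Metric.sphere (0 : Plane) 1 by simp [norm_smul, hy'.ne'])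
  simp only [Set.mem_ofPred_eq, Pi.div_apply, hfh, quad_smul] at this
  rwa [mul_div_mul_left _ _ (by positivity),
    div_le_div_iff₀ (quad_zero_pos (hne x hx)) (quad_zero_pos hy)] at this

/-- The smallest Euclidean disc around the origin containing the ball of `N` touches it. -/
theorem exists_lower {N : Seminorm ℝ Plane} (hN : Definite N) :
    ∃ u v, area u v ≠ 0 ∧ Lower N u v := by
  obtain ⟨x, hx, h⟩ := exists_min_ratio_circle (continuous_sq_seminorm N) (sq_seminorm_smul N)
  have hq := quad_zero_pos hx
  have hNx := hN.pos hx
  have he : N x ^ 2 / quad 0 x * quad 0 x = N x ^ 2 := div_mul_cancel₀ _ hq.ne'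
  obtain ⟨v, hv, ha⟩ := exists_conjugate_pair (k := 0) (l := N x ^ 2 / quad 0 x) (by norm_num)
    (by positivity) hq
  refine ⟨_, v, ?_, map_inv_sqrt_smul N (by positivity) he, Eventually.of_forall fun b => ?_⟩
  · rintro h0; simp [h0] at ha
  · rw [← hv, div_mul_eq_mul_div, div_le_iff₀ hq]
    exact h _

theorem exists_upper {M : Seminorm ℝ Plane} (hM : Definite M) :
    ∃ u v, area u v ≠ 0 ∧ Upper M u v := by
  obtain ⟨x, hx, h⟩ := exists_min_ratio_circle (f := fun x => -(M x ^ 2))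
    (continuous_sq_seminorm M).neg (fun t x => by rw [sq_seminorm_smul]; ring)
  simp only [neg_mul, neg_le_neg_iff] at h
  have hq := quad_zero_pos hx
  have hMx := hM.pos hx
  have he : M x ^ 2 / quad 0 x * quad 0 x = M x ^ 2 := div_mul_cancel₀ _ hq.ne'
  obtain ⟨v, hv, ha⟩ := exists_conjugate_pair (k := 0) (l := M x ^ 2 / quad 0 x) (by norm_num)
    (by positivity) hq
  refine ⟨_, v, ?_, map_inv_sqrt_smul M (by positivity) he, Eventually.of_forall fun b => ?_⟩
  · rintro h0; simp [h0] at ha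
  · have := h ((√(M x ^ 2 / quad 0 x * quad 0 x))⁻¹ • x + b • v)
    rwa [← le_div_iff₀ hq, mul_div_right_comm, hv] at this

/-- `D` is the supremum of the squared areas of `Upper` frames. -/
theorem exists_area_separation {N M : Seminorm ℝ Plane} (hN : Definite N) (hM : Definite M)
    (h : ContactConnected N M)
    (hdet : ∀ u v, (∀ x, M (frame u v x) ≤ N x) → |area u v| ≤ 1) :
    ∃ D > 0, (∀ u v, area u v ≠ 0 → Lower N u v → D ≤ area u v ^ 2) ∧
      ∀ u v, Upper M u v → area u v ^ 2 ≤ D := by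
  have hle : ∀ u v w z, area u v ≠ 0 → Lower N u v → Upper M w z →
      area w z ^ 2 ≤ area u v ^ 2 := fun u v w z huv hl hu =>
    sq_le_sq.2 (area_le_of_osculating hN h hdet huv hl hu)
  obtain ⟨u₀, v₀, ha₀, hl₀⟩ := exists_lower hN
  obtain ⟨w₀, z₀, hb₀, hu₀⟩ := exists_upper hM
  set S : Set ℝ := {c | ∃ w z, Upper M w z ∧ c = area w z ^ 2}
  have hne : S.Nonempty := ⟨_, w₀, z₀, hu₀, rfl⟩
  have hbdd : BddAbove S := ⟨area u₀ v₀ ^ 2, by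
    rintro _ ⟨w, z, hu, rfl⟩
    exact hle _ _ _ _ ha₀ hl₀ hu⟩
  refine ⟨sSup S, ?_, fun u v huv hl => csSup_le hne ?_, fun u v hu =>
    le_csSup hbdd ⟨u, v, hu, rfl⟩⟩
  · exact (show 0 < area w₀ z₀ ^ 2 by positivity).trans_le (le_csSup hbdd ⟨w₀, z₀, hu₀, rfl⟩)
  · rintro _ ⟨w, z, hu, rfl⟩
    exact hle _ _ _ _ huv hl hu

/-! ### Contacts of a maximal contraction -/

/-- If all contacts lie on the first axis, shrinking it allows for expanding the second one. -/
theorem exists_expansion {N M : Seminorm ℝ Plane} (hN : Definite N) (hMN : ∀ x, M x ≤ N x)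
    (hc : ∀ x, N x = 1 → M x = 1 → x.2 = 0) :
    ∃ s : ℝ, 0 < s ∧ s < 1 / 2 ∧ ∀ x, M (frame (1 - s, 0) (0, 1 + 2 * s) x) ≤ N x := by
  have hB : ∀ (s : ℝ) (x : Plane),
      frame (1 - s, 0) (0, 1 + 2 * s) x = ((1 - s) * x.1, (1 + 2 * s) * x.2) := fun s x => by
    ext <;> simp [frame_apply, mul_comm]
  have hcont : Continuous fun x : Plane => 3 * M (0, x.2) :=
    continuous_const.mul ((seminorm_continuous M).comp (by fun_prop))
  have hK : IsCompact {x : Plane | N x = 1 ∧ 1 / 2 ≤ 3 * M (0, x.2)} :=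
    (isCompact_unit_sphere hN).inter_right (isClosed_le continuous_const hcont)
  have hF : Continuous fun z : ℝ × Plane => M ((1 - z.1) * z.2.1, (1 + 2 * z.1) * z.2.2) :=
    (seminorm_continuous M).comp (by fun_prop)
  have hev : ∀ᶠ s in 𝓝 (0 : ℝ), ∀ x ∈ {x : Plane | N x = 1 ∧ 1 / 2 ≤ 3 * M (0, x.2)},
      M ((1 - s) * x.1, (1 + 2 * s) * x.2) < 1 := by
    refine hK.eventually_forall_of_forall_eventually fun x hx => ?_
    refine hF.continuousAt.eventually_lt_const ?_
    simp only [sub_zero, one_mul, mul_zero, add_zero]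
    refine lt_of_le_of_ne (hx.1 ▸ hMN x) fun h1 => ?_
    have h2 := hx.2
    rw [hc x hx.1 h1] at h2
    have h3 : M ((0, 0) : Plane) = 0 := map_zero M
    rw [h3] at h2
    norm_num at h2
  obtain ⟨s, hs, hs0, hs1⟩ := ((hev.filter_mono nhdsWithin_le_nhds).and
    (Ioo_mem_nhdsGT (show (0 : ℝ) < 1 / 2 by norm_num))).exists
  refine ⟨s, hs0, hs1, le_of_unit_sphere hN fun x hx => ?_⟩
  rw [hB]
  rcases le_or_gt (1 / 2) (3 * M (0, x.2)) with h | h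
  · exact (hs x ⟨hx, h⟩).le
  -- Off the compact set the image is `(1 - s) • x + 3 s • (0, x.2)`, of norm at most `1 - s + s /
  -- 2`.
  · have h1 : (((1 - s) * x.1, (1 + 2 * s) * x.2) : Plane) =
        (1 - s) • x + (3 * s) • ((0, x.2) : Plane) := by
      ext <;> simp
      ring
    have h2 := map_add_le_add M ((1 - s) • x) ((3 * s) • ((0, x.2) : Plane))
    rw [← h1, map_smul_eq_mul, map_smul_eq_mul, Real.norm_of_nonneg (by linarith),
      Real.norm_of_nonneg (by positivity)] at h2
    have h3 := hMN x
    rw [hx] at h3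
    nlinarith

/-- If all contacts lay on one line, `exists_expansion` would give a contraction of determinant `(1
- s) (1 + 2 s) > 1`. -/
theorem exists_independent_contacts {N M : Seminorm ℝ Plane} (hN : Definite N)
    (hMN : ∀ x, M x ≤ N x)
    (hdet : ∀ u v, (∀ x, M (frame u v x) ≤ N x) → |area u v| ≤ 1) :
    ∃ p q, area p q ≠ 0 ∧ (N p = 1 ∧ M p = 1) ∧ (N q = 1 ∧ M q = 1) := by
  by_contra! hno
  obtain ⟨p, hp0, hp⟩ : ∃ p : Plane, p ≠ 0 ∧ ∀ x, N x = 1 → M x = 1 → area p x = 0 := by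
    by_cases h : ∃ p, N p = 1 ∧ M p = 1
    · obtain ⟨p, hp⟩ := h
      refine ⟨p, by rintro rfl; simp at hp, fun x h1 h2 => ?_⟩
      by_contra h3
      exact hno p x h3 hp h1 h2
    · push Not at h
      exact ⟨(1, 0), by simp, fun x h1 h2 => absurd h2 (h x h1)⟩
  have hq := quad_zero_pos hp0
  have hpq : area p (-p.2, p.1) ≠ 0 := by
    have : area p (-p.2, p.1) = quad 0 p := by simp only [area, quad]; ring
    rw [this]
    exact hq.ne'
  set F := frame p (-p.2, p.1) with hF
  set G := frameInv p (-p.2, p.1)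
  obtain ⟨s, hs0, hs1, hs⟩ := exists_expansion (N := N.comp F) (M := M.comp F) (hN.comp hpq)
    (fun x => hMN _) fun x h1 h2 => by
      have h3 := hp _ h1 h2
      have h4 := area_frame p (-p.2, p.1) (1, 0) x
      rw [frame_one_zero, h3] at h4
      have h5 := (mul_eq_zero.1 h4.symm).resolve_right hpq
      simpa [area] using h5
  set B := frame (1 - s, 0) (0, 1 + 2 * s)
  have hcontr : ∀ x, M ((F ∘ₗ B ∘ₗ G) x) ≤ N x := fun x => by
    have := hs (G x)
    rwa [Seminorm.comp_apply, Seminorm.comp_apply, frame_frameInv hpq] at this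
  rw [eq_frame (F ∘ₗ B ∘ₗ G)] at hcontr
  have hd := hdet _ _ hcontr
  have h1 : area (G (1, 0)) (G (0, 1)) * area p (-p.2, p.1) = 1 := by
    rw [← area_frame, frame_frameInv hpq, frame_frameInv hpq]
    simp [area]
  have h2 : area ((F ∘ₗ B ∘ₗ G) (1, 0)) ((F ∘ₗ B ∘ₗ G) (0, 1)) = (1 - s) * (1 + 2 * s) := by
    simp only [LinearMap.comp_apply]
    rw [area_frame, area_frame, mul_right_comm, h1, one_mul]
    simp [area]
  rw [h2, abs_of_pos (by nlinarith)] at hd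
  nlinarith

/-- Between two independent contacts there is a whole sector of contacts. -/
theorem exists_contact_sector {N M : Seminorm ℝ Plane}
    (h : ContactConnected N M) (hMN : ∀ x, M x ≤ N x) {p q : Plane} (hpq : area p q ≠ 0)
    (hp : N p = 1 ∧ M p = 1) (hq : N q = 1 ∧ M q = 1) :
    ∃ q', area p q' ≠ 0 ∧ N q' = 1 ∧
      ∀ a b : ℝ, 0 < a → 0 < b → N (a • p + b • q') = M (a • p + b • q') := by
  obtain ⟨D, hD, hDe⟩ := h LinearMap.id hMN
  simp only [LinearMap.id_apply] at hDe
  obtain ⟨p', hp'D, hp'⟩ : ∃ p' ∈ D, p' = p ∨ p' = -p := by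
    have : p ∈ D ∪ -D := hDe ▸ hp
    rcases this with h | h
    exacts [⟨p, h, Or.inl rfl⟩, ⟨-p, h, Or.inr rfl⟩]
  obtain ⟨q', hq'D, hq'⟩ : ∃ q' ∈ D, q' = q ∨ q' = -q := by
    have : q ∈ D ∪ -D := hDe ▸ hq
    rcases this with h | h
    exacts [⟨q, h, Or.inl rfl⟩, ⟨-q, h, Or.inr rfl⟩]
  by_contra! hno
  obtain ⟨a, b, ha, hb, hv⟩ := hno q hpq hq.1
  obtain ⟨c, d, hc, hd, hw⟩ := hno (-q) (by
    have : area p (-q) = -area p q := by simp only [area, Prod.fst_neg, Prod.snd_neg]; ring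
    rw [this]; exact neg_ne_zero.2 hpq) (by rw [map_neg_eq_map]; exact hq.1)
  set v := a • p + b • q with hvdef
  -- If both adjacent sectors contain non-contact directions `v` and `w`, their lines separate `±p`
  -- from `±q`; the product of areas changes sign on `D`, so `D` would meet one of these lines.
  set w := c • p + d • -q with hwdef
  have hpar : ∀ x ∈ D, ∀ z, N z ≠ M z → area x z ≠ 0 := by
    intro x hx z hz h0
    have hxC : N x = 1 ∧ M x = 1 := by
      have : x ∈ {x | N x = 1 ∧ M x = 1} := hDe ▸ Or.inl hx
      exact this
    have hx0 : x ≠ 0 := by rintro rfl; simp at hxC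
    have hq := quad_zero_pos hx0
    have : z = ((x.1 * z.1 + x.2 * z.2) / quad 0 x) • x := by
      simp only [area] at h0
      ext
      · simp only [Prod.smul_fst, smul_eq_mul]
        field_simp
        simp only [quad]
        linear_combination -x.2 * h0
      · simp only [Prod.smul_snd, smul_eq_mul]
        field_simp
        simp only [quad]
        linear_combination x.1 * h0
    apply hz
    rw [this, map_smul_eq_mul, map_smul_eq_mul, hxC.1, hxC.2]
  have hgc : Continuous fun x : Plane => area x v * area x w := by
    simp only [area]
    fun_prop
  have hp1 : area p' v * area p' w < 0 := by
    have : area p' v * area p' w = -(b * d * area p q ^ 2) := by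
      rcases hp' with rfl | rfl <;>
      · simp only [area, hvdef, hwdef, Prod.fst_add, Prod.snd_add, Prod.smul_fst, Prod.smul_snd,
          Prod.fst_neg, Prod.snd_neg, smul_eq_mul]
        ring
    rw [this, neg_lt_zero]
    positivity
  have hq1 : 0 < area q' v * area q' w := by
    have : area q' v * area q' w = a * c * area p q ^ 2 := by
      rcases hq' with rfl | rfl <;>
      · simp only [area, hvdef, hwdef, Prod.fst_add, Prod.snd_add, Prod.smul_fst, Prod.smul_snd,
          Prod.fst_neg, Prod.snd_neg, smul_eq_mul]
        ring
    rw [this]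
    positivity
  obtain ⟨x, hxD, hx⟩ := hD.intermediate_value hp'D hq'D hgc.continuousOn
    (show (0 : ℝ) ∈ Set.Icc _ _ from ⟨hp1.le, hq1.le⟩)
  rcases mul_eq_zero.1 hx with h0 | h0
  · exact hpar x hxD v hv h0
  · exact hpar x hxD w hw h0

/-- The far side of a sector can be moved close to the near one. -/
theorem exists_close_sector {N M : Seminorm ℝ Plane} (hN : Definite N) {p q : Plane}
    (hpq : area p q ≠ 0) (hp : N p = 1) (hq : N q = 1)
    (h : ∀ a b : ℝ, 0 < a → 0 < b → N (a • p + b • q) = M (a • p + b • q)) :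
    ∃ q', area p q' ≠ 0 ∧ N q' = 1 ∧ N (p - q') ≤ 1 / 2 ∧ M q' = 1 ∧
      ∀ a b : ℝ, 0 < a → 0 < b → N (a • p + b • q') = M (a • p + b • q') := by
  set z := p + (1 / 4 : ℝ) • q with hz
  have haz : area p z = 1 / 4 * area p q := by
    simp only [hz, area, Prod.fst_add, Prod.snd_add, Prod.smul_fst, Prod.smul_snd, smul_eq_mul]
    ring
  have hz0 : z ≠ 0 := by
    intro h0
    rw [h0] at haz
    refine hpq ?_
    simp [area] at haz
    simp only [area]
    linarith
  set n := N z with hn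
  have hn0 : 0 < n := hN.pos hz0
  have hNM : N z = M z := by
    have := h 1 (1 / 4) one_pos (by norm_num)
    rwa [one_smul, ← hz] at this
  have hq4 : N ((1 / 4 : ℝ) • q) = 1 / 4 := by
    rw [map_smul_eq_mul, hq, Real.norm_of_nonneg (by norm_num), mul_one]
  have habs : |n - 1| ≤ 1 / 4 := by
    have := abs_sub_map_le_sub N z p
    rwa [hz, add_sub_cancel_left, ← hz, hq4, hp] at this
  refine ⟨n⁻¹ • z, ?_, ?_, ?_, ?_, fun a b ha hb => ?_⟩
  · have : area p (n⁻¹ • z) = n⁻¹ * area p z := by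
      simp only [area, Prod.smul_fst, Prod.smul_snd, smul_eq_mul]
      ring
    rw [this, haz]
    positivity
  · rw [map_smul_eq_mul, Real.norm_of_nonneg (by positivity), inv_mul_cancel₀ hn0.ne']
  · have h1 : p - n⁻¹ • z = (1 - n⁻¹) • z - (1 / 4 : ℝ) • q := by rw [hz]; module
    have h3 : N ((1 - n⁻¹) • z) = |n - 1| := by
      rw [map_smul_eq_mul, ← hn, Real.norm_eq_abs, ← abs_of_pos hn0, ← abs_mul, abs_of_pos hn0,
        sub_mul, inv_mul_cancel₀ hn0.ne', one_mul]
    have h4 := map_sub_le_add N ((1 - n⁻¹) • z) ((1 / 4 : ℝ) • q)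
    rw [← h1, h3, hq4] at h4
    linarith
  · rw [map_smul_eq_mul, Real.norm_of_nonneg (by positivity), ← hNM, inv_mul_cancel₀ hn0.ne']
  · have : a • p + b • n⁻¹ • z = (a + b * n⁻¹) • p + (b * n⁻¹ * (1 / 4)) • q := by
      rw [hz]; module
    rw [this]
    exact h _ _ (by positivity) (by positivity)

/-- On a sector of contacts the two norms are given by a quadratic form. -/
theorem exists_quad_eq {N M : Seminorm ℝ Plane} (hN1 : N (1, 0) = 1) (hM1 : M (1, 0) = 1)
    (hN2 : N (0, 1) = 1) (hM2 : M (0, 1) = 1) (hcl : N (1, -1) ≤ 1 / 2)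
    (hNM : ∀ x : Plane, 0 < x.1 → 0 < x.2 → N x = M x) {D : ℝ}
    (hl : ∀ u v, area u v ≠ 0 → Lower N u v → D ≤ area u v ^ 2)
    (hu : ∀ u v, Upper M u v → area u v ^ 2 ≤ D) :
    ∃ k : ℝ, 0 ≤ k ∧ k < 1 ∧ D * (1 - k ^ 2) = 1 ∧
      ∀ x : Plane, 0 < x.1 → 0 < x.2 → N x ^ 2 = quad k x := by
  have hN0 := quad_zero_le_sq_of_close hN1 hN2 hcl
  -- If `D < 1`, both norms equal the form with `k = 0` at `(1, 1)`, where touching gives an `Upper`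
  -- frame of squared area 1.
  rcases lt_or_ge D 1 with hD | hD
  · exfalso
    have hM0 := sq_le_quad hM1 hM2 hu le_rfl zero_lt_one (by nlinarith)
    have heq : 1 * quad 0 (1, 1) = M (1, 1) ^ 2 := by
      rw [one_mul]
      refine le_antisymm ?_ (hM0 _ (by simp) (by simp))
      rw [← hNM _ (by simp) (by simp)]
      exact hN0 _ (by simp) (by simp)
    obtain ⟨u, v, huv, ha⟩ := exists_upper_of_touching (M := M) (k := 0) (l := 1) (by norm_num)
      one_pos (x := (1, 1)) (by simp) (by simp) (by norm_num [quad]) heq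
      fun y h1 h2 => by rw [one_mul]; exact hM0 y h1.le h2.le
    have := hu u v huv
    rw [one_pow, zero_pow two_ne_zero, sub_zero, mul_one, mul_one] at ha
    linarith
  · have hD0 : 0 < D := by linarith
    have h1 : D⁻¹ ≤ 1 := inv_le_one_of_one_le₀ hD
    have hk2 : √(1 - D⁻¹) ^ 2 = 1 - D⁻¹ := Real.sq_sqrt (by linarith)
    have hDk : D * (1 - √(1 - D⁻¹) ^ 2) = 1 := by
      rw [hk2, sub_sub_cancel, mul_inv_cancel₀ hD0.ne']
    have hk1 : √(1 - D⁻¹) < 1 := by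
      rw [Real.sqrt_lt' one_pos]
      have := inv_pos.2 hD0
      linarith
    refine ⟨√(1 - D⁻¹), Real.sqrt_nonneg _, hk1, hDk, fun x h1 h2 => le_antisymm ?_ ?_⟩
    · rw [hNM x h1 h2]
      exact sq_le_quad hM1 hM2 hu (Real.sqrt_nonneg _) hk1 hDk.le x h1.le h2.le
    · exact quad_le_sq hN1 hN2 hN0 hl (Real.sqrt_nonneg _) hk1 hDk.ge x h1.le h2.le

theorem eventually_circlePoint_eq_one {N : Seminorm ℝ Plane}
    (h : ∀ᶠ b : ℝ in 𝓝 0, N (1, b) ^ 2 = 1 + b ^ 2) :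
    ∀ᶠ φ in 𝓝 (0 : ℝ), N (circlePoint φ) = 1 := by
  have hcos : ∀ᶠ φ : ℝ in 𝓝 0, 0 < Real.cos φ :=
    Real.continuous_cos.continuousAt.eventually_const_lt (by simp)
  have htan : Tendsto Real.tan (𝓝 0) (𝓝 0) := by
    have := (Real.continuousAt_tan (x := 0)).2 (by simp)
    simpa using this.tendsto
  filter_upwards [hcos, htan.eventually h] with φ hφ ht
  have h1 : circlePoint φ = Real.cos φ • ((1, Real.tan φ) : Plane) := by
    ext
    · simp [circlePoint]
    · simp [circlePoint, Real.tan_eq_sin_div_cos, mul_div_cancel₀ _ hφ.ne']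
  have h2 : N (circlePoint φ) ^ 2 = 1 := by
    rw [h1, sq_seminorm_smul, ht, Real.tan_eq_sin_div_cos, div_pow]
    field_simp
    exact Real.cos_sq_add_sin_sq φ
  exact (pow_eq_one_iff_of_nonneg (apply_nonneg N _) two_ne_zero).1 h2

/-! ### The parallelogram law for two norms on the plane -/

theorem parallelogram_of_maximal {N M : Seminorm ℝ Plane} (hN : Definite N) (hM : Definite M)
    (h : ContactConnected N M) (hMN : ∀ x, M x ≤ N x)
    (hdet : ∀ u v, (∀ x, M (frame u v x) ≤ N x) → |area u v| ≤ 1) (x y : Plane) :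
    M (x + y) ^ 2 + M (x - y) ^ 2 = 2 * (M x ^ 2 + M y ^ 2) := by
  obtain ⟨D, hD, hl, hu⟩ := exists_area_separation hN hM h hdet
  obtain ⟨p, q₁, hpq₁, hp, hq₁⟩ := exists_independent_contacts hN hMN hdet
  obtain ⟨q₂, hpq₂, hq₂, hsec₂⟩ := exists_contact_sector h hMN hpq₁ hp hq₁
  obtain ⟨q, hpq, hq, hcl, hMq, hsec⟩ := exists_close_sector hN hpq₂ hp.1 hq₂ hsec₂
  obtain ⟨k, hk0, hk1, hDk, hquad⟩ := exists_quad_eq (N := N.comp (frame p q))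
    (M := M.comp (frame p q)) (by simpa using hp.1) (by simpa using hp.2) (by simpa using hq)
    (by simpa using hMq) (by simpa [frame_mk, sub_eq_add_neg] using hcl)
    (fun x h1 h2 => hsec x.1 x.2 h1 h2) (lower_bound_comp hl hpq) (upper_bound_comp hu hpq)
  -- The point `(1, 1)` is interior to the sector, so in the frame conjugate there both norms are
  -- Euclidean near the first axis, and the separating constant becomes 1.
  obtain ⟨v, hv, ha⟩ := exists_conjugate_pair (k := k) (l := 1) (x := (1, 1)) (by nlinarith)
    one_pos (quad_pos hk0 (by simp) (by simp) (by simp))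
  set u : Plane := (√(1 * quad k (1, 1)))⁻¹ • (1, 1) with hudef
  have hu0 : 0 < (√(1 * quad k (1, 1)))⁻¹ := by
    have := quad_pos hk0 (x := (1, 1)) (by simp) (by simp) (by simp)
    positivity
  have huv : area u v ≠ 0 := by rintro h0; simp [h0] at ha
  set P := frame p q u with hP
  set Q := frame p q v with hQ
  have hPQ : area P Q ≠ 0 := by rw [area_frame]; exact mul_ne_zero huv hpq
  have hbound : D / area P Q ^ 2 = 1 := by
    rw [area_frame, mul_pow]
    rw [div_mul_eq_mul_div, div_eq_one_iff_eq (by positivity)] at hDk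
    rw [div_eq_one_iff_eq (by positivity)]
    rw [one_pow, one_mul] at ha
    linear_combination area u v ^ 2 * hDk - D * ha
  have hev : ∀ᶠ b : ℝ in 𝓝 0, 0 < (u + b • v).1 ∧ 0 < (u + b • v).2 :=
    eventually_mem_quadrant (by simpa [hudef] using hu0) (by simpa [hudef] using hu0) v
  have hframe : ∀ b : ℝ, frame P Q (1, b) = frame p q (u + b • v) := fun b => by
    rw [frame_mk, one_smul, hP, hQ, map_add, LinearMap.map_smul (frame p q) b v]
  have hNloc : ∀ᶠ b : ℝ in 𝓝 0, (N.comp (frame P Q)) (1, b) ^ 2 = 1 + b ^ 2 := by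
    filter_upwards [hev] with b hb
    rw [Seminorm.comp_apply, hframe, ← hv b, one_mul]
    exact hquad _ hb.1 hb.2
  have hMloc : ∀ᶠ b : ℝ in 𝓝 0, (M.comp (frame P Q)) (1, b) ^ 2 = 1 + b ^ 2 := by
    filter_upwards [hev, hNloc] with b hb hNb
    rw [← hNb, Seminorm.comp_apply, Seminorm.comp_apply, hframe]
    exact congrArg (· ^ 2) (hsec _ _ hb.1 hb.2).symm
  have hsq := sq_eq_of_local (N := N.comp (frame P Q)) (M := M.comp (frame P Q)) (hN.comp hPQ)
    (hM.comp hPQ) (fun x => hMN _)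
    (by simpa only [hbound] using lower_bound_comp hl hPQ)
    (by simpa only [hbound] using upper_bound_comp hu hPQ)
    ⟨0, (eventually_circlePoint_eq_one hNloc).and (eventually_circlePoint_eq_one hMloc)⟩
  have hform : ∀ z, M z ^ 2 = (frameInv P Q z).1 ^ 2 + (frameInv P Q z).2 ^ 2 := fun z => by
    have := hsq (frameInv P Q z)
    rwa [Seminorm.comp_apply, frame_frameInv hPQ] at this
  simp only [hform, map_add, map_sub, Prod.fst_add, Prod.snd_add, Prod.fst_sub, Prod.snd_sub]
  ring

/-- The contractions form a compact set containing a small homothety, so the maximal area is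
positive. -/
theorem exists_maximal_contraction {N M : Seminorm ℝ Plane} (hN : Definite N) (hM : Definite M) :
    ∃ p q, area p q ≠ 0 ∧ (∀ x, M (frame p q x) ≤ N x) ∧
      ∀ u v, (∀ x, M (frame u v x) ≤ N x) → |area u v| ≤ |area p q| := by
  obtain ⟨c, hc, hcM⟩ := exists_mul_norm_le hM
  obtain ⟨e, he, heN⟩ := exists_mul_norm_le hN
  have hK : IsCompact {z : Plane × Plane | ∀ x, M (frame z.1 z.2 x) ≤ N x} := by
    refine (isCompact_closedBall (0 : Plane × Plane)
      (max (N (1, 0) / c) (N (0, 1) / c))).of_isClosed_subset ?_ ?_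
    · simp only [Set.ofPred_forall, frame_apply]
      exact isClosed_iInter fun x => isClosed_le ((seminorm_continuous M).comp (by fun_prop))
        continuous_const
    · intro z hz
      rw [mem_closedBall_zero_iff, Prod.norm_def]
      refine max_le_max ?_ ?_
      · rw [le_div_iff₀ hc, mul_comm]
        simpa using (hcM z.1).trans (by simpa using hz (1, 0))
      · rw [le_div_iff₀ hc, mul_comm]
        simpa using (hcM z.2).trans (by simpa using hz (0, 1))
  have hne : ((0, 0) : Plane × Plane) ∈ {z : Plane × Plane | ∀ x, M (frame z.1 z.2 x) ≤ N x} := by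
    intro x
    simp [frame_apply]
  obtain ⟨⟨p, q⟩, hpq, hmax⟩ := hK.exists_isMaxOn ⟨_, hne⟩
    (f := fun z : Plane × Plane => |area z.1 z.2|) (by
      simp only [area]
      fun_prop)
  have hmax' : ∀ u v, (∀ x, M (frame u v x) ≤ N x) → |area u v| ≤ |area p q| := fun u v huv =>
    hmax (show ((u, v) : Plane × Plane) ∈ _ from huv)
  refine ⟨p, q, ?_, hpq, hmax'⟩
  set C := M (1, 0) + M (0, 1)
  have hC : 0 < C := add_pos (hM.pos (by simp)) (hM.pos (by simp))
  have hr : 0 < e / C := by positivity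
  have := hmax' (e / C, 0) (0, e / C) fun x => by
    have h1 : frame (e / C, 0) (0, e / C) x = (e / C) • x := by
      ext <;> simp [frame_apply, mul_comm]
    rw [h1, map_smul_eq_mul, Real.norm_of_nonneg hr.le]
    calc e / C * M x ≤ e / C * (C * ‖x‖) := by gcongr; exact seminorm_le_mul_norm M x
      _ = e * ‖x‖ := by field_simp
      _ ≤ N x := heN x
  rw [← abs_pos]
  refine lt_of_lt_of_le ?_ this
  simp only [area, mul_zero, sub_zero]
  positivity

theorem parallelogram_of_contactConnected {N M : Seminorm ℝ Plane} (hN : Definite N)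
    (hM : Definite M) (h : ContactConnected N M) (x y : Plane) :
    M (x + y) ^ 2 + M (x - y) ^ 2 = 2 * (M x ^ 2 + M y ^ 2) := by
  obtain ⟨p, q, hpq, hc, hmax⟩ := exists_maximal_contraction hN hM
  have := parallelogram_of_maximal hN (hM.comp hpq) (h.comp_right _) hc
    (fun u v huv => by
      have h1 := hmax (frame p q u) (frame p q v) fun x => by
        have h2 := huv x
        rw [Seminorm.comp_apply, frame_apply u v, map_add, map_smul, map_smul] at h2
        exact h2
      rw [area_frame, abs_mul] at h1
      exact le_of_mul_le_mul_right (by rwa [one_mul]) (abs_pos.2 hpq))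
    (frameInv p q x) (frameInv p q y)
  simpa only [Seminorm.comp_apply, map_add, map_sub, frame_frameInv hpq] using this

end Plane

/-! ### Norm attainment sets and reduction to the plane -/

section

variable {X : Type*} [NormedAddCommGroup X] [NormedSpace ℝ X]

theorem isPreconnected_unit_sphere_submodule (V : Submodule ℝ X) :
    ∃ D : Set X, D ⊆ Metric.sphere (0 : X) 1 ∧ IsPreconnected D ∧
      {x : X | x ∈ V ∧ ‖x‖ = 1} = D ∪ (-D) := by
  rcases lt_or_ge 1 (Module.rank ℝ V) with hV | hV
  · refine ⟨V.subtype '' Metric.sphere (0 : V) 1, ?_,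
      (isPreconnected_sphere hV 0 1).image _ continuous_subtype_val.continuousOn, ?_⟩
    · rintro _ ⟨x, hx, rfl⟩
      simpa using hx
    · ext x
      simp [and_comm]
  · rw [rank_le_one_iff] at hV
    obtain ⟨v, hv⟩ := hV
    rcases eq_or_ne v 0 with rfl | hv0
    · refine ⟨∅, by simp, isPreconnected_empty, ?_⟩
      ext x
      simp only [Set.mem_ofPred_eq, Set.neg_empty, Set.union_empty, Set.mem_empty_iff_false,
        iff_false, not_and]
      intro hx
      obtain ⟨r, hr⟩ := hv ⟨x, hx⟩
      have : x = 0 := by simpa using (congrArg Subtype.val hr).symm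
      simp [this]
    · have hn : (0 : ℝ) < ‖(v : X)‖ := by simpa using hv0
      refine ⟨{‖(v : X)‖⁻¹ • (v : X)}, ?_, isPreconnected_singleton, ?_⟩
      · simp [norm_smul, hn.ne']
      · ext x
        simp only [Set.mem_ofPred_eq, Set.neg_singleton, Set.mem_union, Set.mem_singleton_iff]
        constructor
        · rintro ⟨hx, hx1⟩
          obtain ⟨r, hr⟩ := hv ⟨x, hx⟩
          have hr' : r • (v : X) = x := congrArg Subtype.val hr
          rw [← hr', norm_smul, Real.norm_eq_abs] at hx1
          have habs : |r| = ‖(v : X)‖⁻¹ := eq_inv_of_mul_eq_one_left hx1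
          rcases abs_choice r with h | h
          · left; rw [← hr', ← habs, h]
          · right; rw [← hr', ← habs, h, neg_smul, neg_neg]
        · rintro (rfl | rfl)
          · exact ⟨V.smul_mem _ v.2, by simp [norm_smul, hn.ne']⟩
          · exact ⟨V.neg_mem (V.smul_mem _ v.2), by simp [norm_smul, hn.ne']⟩

/-- Adding the bounds for `T (x + y)` and `T (x - y)` gives equality by the two parallelogram laws,
so each bound is an equality. -/
theorem normAttainmentSet_eq_of_parallelogram {Y : Type*} [NormedAddCommGroup Y] [NormedSpace ℝ Y]
    (hX : ∀ x y : X, ‖x + y‖ ^ 2 + ‖x - y‖ ^ 2 = 2 * (‖x‖ ^ 2 + ‖y‖ ^ 2))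
    (hY : ∀ x y : Y, ‖x + y‖ ^ 2 + ‖x - y‖ ^ 2 = 2 * (‖x‖ ^ 2 + ‖y‖ ^ 2)) (T : X →L[ℝ] Y) :
    ∃ V : Submodule ℝ X, normAttainmentSet T = {x : X | x ∈ V ∧ ‖x‖ = 1} := by
  refine ⟨
    { carrier := {x | ‖T x‖ = ‖T‖ * ‖x‖}
      add_mem' := ?_
      zero_mem' := by simp
      smul_mem' := ?_ }, ?_⟩
  · intro x y hx hy
    rw [Set.mem_ofPred_eq] at hx hy ⊢
    have h1 := hX x y
    have h2 := hY (T x) (T y)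
    rw [← map_add, ← map_sub, hx, hy] at h2
    have h3 := T.le_opNorm (x + y)
    have h4 := pow_le_pow_left₀ (norm_nonneg _) (T.le_opNorm (x - y)) 2
    refine le_antisymm h3 (le_of_sq_le_sq ?_ (norm_nonneg _))
    have h5 : ‖T‖ ^ 2 * (‖x + y‖ ^ 2 + ‖x - y‖ ^ 2) = ‖T‖ ^ 2 * (2 * (‖x‖ ^ 2 + ‖y‖ ^ 2)) := by
      rw [h1]
    nlinarith
  · intro c x hx
    rw [Set.mem_ofPred_eq] at hx ⊢
    rw [map_smul, norm_smul, norm_smul, hx]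
    ring
  · ext x
    simp only [normAttainmentSet, mem_sphere_iff_norm, sub_zero, Set.mem_ofPred_eq,
      Submodule.mem_mk, AddSubmonoid.mem_mk, AddSubsemigroup.mem_mk]
    constructor
    · rintro ⟨h1, h2⟩
      exact ⟨by rw [h1, h2, mul_one], h1⟩
    · rintro ⟨h1, h2⟩
      exact ⟨h2, by rw [h1, h2, mul_one]⟩

variable [FiniteDimensional ℝ X]

theorem exists_norm_eq_quotient_norm (W : Submodule ℝ X) (x : X) :
    ∃ y : X, W.mkQ y = W.mkQ x ∧ ‖y‖ = ‖W.mkQ x‖ := by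
  have : ProperSpace X := FiniteDimensional.proper ℝ X
  obtain ⟨w, hw, hd⟩ := (W.closed_of_finiteDimensional).exists_infDist_eq_dist ⟨0, W.zero_mem⟩ x
  refine ⟨x - w, by simpa using hw, ?_⟩
  rw [← dist_eq_norm, ← hd]
  exact (QuotientAddGroup.norm_mk (S := W.toAddSubgroup) x).symm

theorem parallelogram_of_contacts_connected
    (h : ∀ T : X →L[ℝ] X, ∃ D : Set X, D ⊆ Metric.sphere (0 : X) 1 ∧ IsPreconnected D ∧
        normAttainmentSet T = D ∪ (-D)) (x y : X) :
    ‖x + y‖ ^ 2 + ‖x - y‖ ^ 2 = 2 * (‖x‖ ^ 2 + ‖y‖ ^ 2) := by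
  by_cases hxy : LinearIndependent ℝ ![x, y]
  · let L : Plane →ₗ[ℝ] X :=
      (LinearMap.fst ℝ ℝ ℝ).smulRight x + (LinearMap.snd ℝ ℝ ℝ).smulRight y
    have hL : ∀ a : Plane, L a = a.1 • x + a.2 • y := fun a => rfl
    have hL0 : ∀ a : Plane, L a = 0 → a = 0 := by
      intro a ha
      have := LinearIndependent.pair_iff.1 hxy a.1 a.2 ha
      exact Prod.ext this.1 this.2
    obtain ⟨p, hp⟩ := L.exists_leftInverse_of_injective (LinearMap.ker_eq_bot'.2 hL0)
    have hpL : ∀ a, p (L a) = a := fun a => LinearMap.congr_fun hp a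
    set W := LinearMap.ker p
    have hWc : IsClosed (W : Set X) := W.closed_of_finiteDimensional
    let N : Seminorm ℝ Plane := (normSeminorm ℝ (X ⧸ W)).comp (W.mkQ ∘ₗ L)
    let M : Seminorm ℝ Plane := (normSeminorm ℝ X).comp L
    have hNv : ∀ a, N a = ‖W.mkQ (L a)‖ := fun a => rfl
    have hMv : ∀ a, M a = ‖L a‖ := fun a => rfl
    have hmk : ∀ z, W.mkQ (L (p z)) = W.mkQ z := by
      intro z
      rw [← sub_eq_zero, ← map_sub, Submodule.mkQ_apply, Submodule.Quotient.mk_eq_zero]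
      simp [W, hpL]
    have hNle : ∀ z, N (p z) ≤ ‖z‖ := by
      intro z
      rw [hNv, hmk]
      exact Submodule.Quotient.norm_mk_le W z
    have hlift : ∀ a, ∃ z, p z = a ∧ ‖z‖ = N a := by
      intro a
      obtain ⟨z, hz, hz'⟩ := exists_norm_eq_quotient_norm W (L a)
      refine ⟨z, ?_, hz'⟩
      rw [← sub_eq_zero, ← map_sub, Submodule.mkQ_apply, Submodule.Quotient.mk_eq_zero] at hz
      simpa [W, hpL, sub_eq_zero] using hz
    have hND : Plane.Definite N := by
      intro a ha
      obtain ⟨z, rfl, hz⟩ := hlift a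
      rw [ha, norm_eq_zero] at hz
      simp [hz]
    have hMD : Plane.Definite M := fun a ha => hL0 a (norm_eq_zero.1 ha)
    have hC : Plane.ContactConnected N M := by
      intro B hB
      rcases Set.eq_empty_or_nonempty {x | N x = 1 ∧ M (B x) = 1} with he | ⟨a, ha1, ha2⟩
      · exact ⟨∅, isPreconnected_empty, by simp [he]⟩
      -- The contact `a` forces `‖T‖ = 1`; as quotient norms are attained, `p` maps the norm
      -- attainment set onto the contact set of `B`.
      let T : X →L[ℝ] X := LinearMap.toContinuousLinearMap (L ∘ₗ B ∘ₗ p)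
      have hT : ∀ z, ‖T z‖ = M (B (p z)) := fun z => rfl
      have hT1 : ‖T‖ = 1 := by
        refine le_antisymm (T.opNorm_le_bound zero_le_one fun z => ?_) ?_
        · rw [hT, one_mul]
          exact (hB _).trans (hNle z)
        · obtain ⟨z, rfl, hz⟩ := hlift a
          have := T.le_opNorm z
          rwa [hT, ha2, hz, ha1, mul_one] at this
      obtain ⟨D, -, hD, hDe⟩ := h T
      refine ⟨p '' D, hD.image _ (LinearMap.continuous_of_finiteDimensional _).continuousOn, ?_⟩
      have : {x | N x = 1 ∧ M (B x) = 1} = p '' normAttainmentSet T := by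
        ext b
        constructor
        · rintro ⟨h1, h2⟩
          obtain ⟨z, rfl, hz⟩ := hlift b
          exact ⟨z, ⟨by simp [hz, h1], by rw [hT, h2, hT1]⟩, rfl⟩
        · rintro ⟨z, ⟨hz1, hz2⟩, rfl⟩
          rw [mem_sphere_zero_iff_norm] at hz1
          rw [hT, hT1] at hz2
          exact ⟨le_antisymm (hz1 ▸ hNle z) (hz2 ▸ hB _), hz2⟩
      rw [this, hDe, Set.image_union, Set.image_neg_of_apply_neg_eq_neg fun z _ => map_neg p z]
    have := Plane.parallelogram_of_contactConnected hND hMD hC (1, 0) (0, 1)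
    simpa [hMv, hL, sub_eq_add_neg] using this
  · rcases eq_or_ne x 0 with rfl | hx
    · simp
      ring
    rw [LinearIndependent.pair_iff' hx] at hxy
    push Not at hxy
    obtain ⟨a, rfl⟩ := hxy
    have h1 : x + a • x = (1 + a) • x := by module
    have h2 : x - a • x = (1 - a) • x := by module
    rw [h1, h2, norm_smul, norm_smul, norm_smul]
    simp only [mul_pow, Real.norm_eq_abs, sq_abs]
    ring

end

/-- Connectedness of a set is expressed by `IsPreconnected`, which, unlike `IsConnected`, also
admits the empty set. This matters only for the zero space, where the unit sphere is empty;
otherwise `M_T`, hence `D`, is automatically nonempty. -/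
theorem mainTheorem2 (X : Type*) [NormedAddCommGroup X] [NormedSpace ℝ X]
    [CompleteSpace X] [FiniteDimensional ℝ X] :
    List.TFAE [
      ∀ T : X →L[ℝ] X, ∃ V : Submodule ℝ X,
        normAttainmentSet T = {x : X | x ∈ V ∧ ‖x‖ = 1},
      ∀ T : X →L[ℝ] X, ∃ D : Set X, D ⊆ Metric.sphere (0 : X) 1 ∧ IsPreconnected D ∧
        normAttainmentSet T = D ∪ (-D),
      IsEuclidean X] := by
  tfae_have 1 → 2 := fun h T => by
    obtain ⟨V, hV⟩ := h T
    rw [hV]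
    exact isPreconnected_unit_sphere_submodule V
  tfae_have 2 → 3 := fun h => by
    have := parallelogram_of_contacts_connected h
    exact ⟨inferInstance, InnerProductSpace.ofNorm ℝ fun x y => by
      simpa only [sq] using this x y, rfl⟩
  tfae_have 3 → 1 := fun h T => by
    obtain ⟨-, ip, rfl⟩ := h
    have hX : ∀ x y : X, ‖x + y‖ ^ 2 + ‖x - y‖ ^ 2 = 2 * (‖x‖ ^ 2 + ‖y‖ ^ 2) := fun x y => by
      simpa only [sq] using parallelogram_law_with_norm_mul ℝ x y
    exact normAttainmentSet_eq_of_parallelogram hX hX T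
  tfae_finish
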